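/- Let $\Gamma$ be a finite simple graph with vertex set $X$, and let $G=G(\Gamma)$ be the partially commutative group (right-angled Artin group) with presentation $\langle X\mid [x,y]=1 \text{ for all edges } \{x,y\} \text{ of } \Gamma\rangle$. Write $h^g=g^{-1}hg$. For $Y\subseteq X$ let $Y^\perp=\{u\in X: d(u,y)\le 1 \text{ for all } y\in Y\}$ (so $\emptyset^\perp=X$), and for $x\in X$ put $x^\perp=\{x\}^\perp$ and $\mathfrak a(x)=(x^\perp\setminus\{x\})^\perp$. Let $\Gamma_{x^\perp}$ be the full subgraph of $\Gamma$ on $X\setminus x^\perp$. A vertex $x$ dominates a vertex $u$ if $x^\perp\cap u^\perp=u^\perp\setminus\{u\}$; let $\mathrm{Dom}(x)$ be the set of vertices dominated by $x$. A vertex $u$ is $\mathcal K$-maximal if $\mathfrak a(u)\subseteq\mathfrak a(v)$ implies $\mathfrak a(u)=\mathfrak a(v)$, for all $v\in X$. For $x\in X$ and $Y\subseteq X$ let $\mathcal J_x(Y)$ be the union of $Y$ and all connected components of $\Gamma_{x^\perp}$ that meet $Y$, and let $\mathcal K_x(Y)$ be the union of $Y$ and all sets $\mathfrak a(v)$, $v\in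 X$, that meet $Y\setminus x^\perp$. Put $H_0=Y$, $H_{i+1}=\mathcal K_x(\mathcal J_x(H_i))$, and $\mathcal H_x(Y)=H_n$ for the least $n$ with $H_n=H_{n+1}$; write $\mathcal H_x(y)=\mathcal H_x(\{y\})$. Let $\mathrm{Sol}(x)$ be the set of $\mathcal K$-maximal vertices $u\notin x^\perp$ with $\mathcal H_x(u)\subseteq \mathrm{Dom}(x)\cup x^\perp$. For $x\in X$, $\varepsilon=\pm1$ and (the vertex set of) a connected component $C$ of $\Gamma_{x^\perp}$, let $\alpha_{C,x^{\varepsilon}}$ be the automorphism of $G$ that maps each $y\in C$ to $y^{x^{\varepsilon}}$ and fixes every $y\in X\setminus C$. For $y\in X\setminus x^\perp$, the set $\mathcal H_x(y)\setminus x^\perp$ is a union $C_1\cup\dots\cup C_t$ of (distinct) connected components of $\Gamma_{x^\perp}$, and the basic normal conjugating automorphism $\tilde\alpha_{y,x}$ is the product $\prod_{i=1}^t\alpha_{C_i,x}$ (the factors commute). Define: - $\mathrm{Conj}(G)$: the group of all $\phi\in\mathrm{Aut}(G)$ such that for every $x\in X$ there is $g_x\in G$ with $\phi(x)=x^{g_x}$;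 - $\mathrm{Conj}_N(G)$: the subgroup of all $\phi\in\mathrm{Conj}(G)$ such that for every $x\in X$ there is $f_x\in G$ with $\phi(y)=y^{f_x}$ for all $y\in\mathfrak a(x)$; - $\mathrm{Conj}_S(G)$: the subgroup of $\mathrm{Aut}(G)$ generated by all $\alpha_{C,x^{\varepsilon}}$ for which $C$ consists of a single vertex; - $\mathrm{LInn}_N(G)=\{\tilde\alpha_{y,x}: x\in X,\ y\in X\setminus x^\perp\}$; - $\mathrm{Conj}_I(G)$: the subgroup generated by $\{\tilde\alpha_{y,x}: x\in X,\ y\in\mathrm{Sol}(x)\}$. **Proposition.** $\mathrm{Conj}_N(G)$ is generated by $\mathrm{LInn}_N(G)$, and $\mathrm{Conj}_N(G)\cap\mathrm{Conj}_S(G)=\mathrm{Conj}_I(G)$. -/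

import Mathlib

namespace PCGroup

section Graph

variable {V : Type*} (Γ : SimpleGraph V)

/-- The orthogonal complement `Y^⊥`: the vertices at distance at most one from every element
of `Y`. -/
def perp (Y : Set V) : Set V := {u | ∀ y ∈ Y, u = y ∨ Γ.Adj u y}

/-- The star `x^⊥ = {x}^⊥` of a vertex. -/
def star (x : V) : Set V := perp Γ {x}

/-- The admissible set `𝔞(x) = (x^⊥ \ x)^⊥` of a vertex. -/
def adm (x : V) : Set V := perp Γ (star Γ x \ {x})

/-- `Dom(x)`: the set of vertices `y` dominated by `x`, that is `x^⊥ ∩ y^⊥ = y^⊥ \ y`. -/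
def Dom (x : V) : Set V := {y | star Γ x ∩ star Γ y = star Γ y \ {y}}

/-- `x` is `𝒦`-maximal: `𝔞(x)` is maximal with respect to inclusion among the sets `𝔞(y)`. -/
def KMaximal (x : V) : Prop := ∀ y, adm Γ x ⊆ adm Γ y → adm Γ y = adm Γ x

/-- The connected components of `Γ_{x^⊥}`, the full subgraph on the complement of `x^⊥`. -/
abbrev Comp (x : V) : Type _ := (Γ.induce (star Γ x)ᶜ).ConnectedComponent

variable {Γ} in
/-- The vertex set, in `V`, of a connected component of `Γ_{x^⊥}`. -/
def Comp.verts {x : V} (C : Comp Γ x) : Set V := Subtype.val '' C.supp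

/-- `𝒥_x(Y)`: add to `Y` the components of `Γ_{x^⊥}` that meet `Y`. -/
def setJ (x : V) (Y : Set V) : Set V :=
  Y ∪ ⋃ C ∈ {C : Comp Γ x | (Comp.verts C ∩ Y).Nonempty}, Comp.verts C

/-- `𝒦_x(Y)`: add to `Y` the sets `𝔞(v)` that meet `Y \ x^⊥`. -/
def setK (x : V) (Y : Set V) : Set V :=
  Y ∪ ⋃ v ∈ {v : V | (adm Γ v ∩ (Y \ star Γ x)).Nonempty}, adm Γ v

/-- The sequence `H_0 = Y`, `H_{i+1} = 𝒦_x(𝒥_x(H_i))`. -/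
def seqH (x : V) (Y : Set V) : ℕ → Set V
  | 0 => Y
  | i + 1 => setK Γ x (setJ Γ x (seqH x Y i))

theorem subset_setK_setJ (x : V) (Y : Set V) : Y ⊆ setK Γ x (setJ Γ x Y) :=
  Set.Subset.trans (Set.subset_union_left) (Set.subset_union_left)

theorem exists_seqH_stable [Finite V] (x : V) (Y : Set V) :
    ∃ n, seqH Γ x Y n = seqH Γ x Y (n + 1) := by
  have hm : Monotone (seqH Γ x Y) :=
    monotone_nat_of_le_succ fun n => subset_setK_setJ Γ x (seqH Γ x Y n)
  obtain ⟨n, hn⟩ := WellFoundedGT.monotone_chain_condition ⟨seqH Γ x Y, hm⟩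
  exact ⟨n, hn (n + 1) (Nat.le_succ n)⟩

open Classical in
/-- `ℋ_x(Y) = H_n` for the least `n` such that `H_n = H_{n+1}`. -/
noncomputable def setH [Finite V] (x : V) (Y : Set V) : Set V :=
  seqH Γ x Y (Nat.find (exists_seqH_stable Γ x Y))

/-- `Sol_0(x) = {u | ℋ_x(u) ⊆ Dom(x) ∪ x^⊥}`. -/
def Sol₀ [Finite V] (x : V) : Set V := {u | setH Γ x {u} ⊆ Dom Γ x ∪ star Γ x}

/-- `Sol(x)`: the `𝒦`-maximal elements of `Sol_0(x)` outside `x^⊥`. -/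
def Sol [Finite V] (x : V) : Set V := {u | u ∈ Sol₀ Γ x ∧ KMaximal Γ u ∧ u ∉ star Γ x}

end Graph

section Group

variable {V : Type*} (Γ : SimpleGraph V)

/-- The relators `[x, y] = x⁻¹ y⁻¹ x y`, one for each pair of adjacent vertices. -/
def rels : Set (FreeGroup V) :=
  {r | ∃ x y, Γ.Adj x y ∧
    r = (FreeGroup.of x)⁻¹ * (FreeGroup.of y)⁻¹ * FreeGroup.of x * FreeGroup.of y}

/-- The partially commutative group `G(Γ)`. -/
abbrev G : Type _ := PresentedGroup (rels Γ)

/-- The canonical generator of `G(Γ)` given by a vertex. -/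
def gen (v : V) : G Γ := PresentedGroup.of v

theorem gen_comm {v w : V} (h : Γ.Adj v w) : Commute (gen Γ v) (gen Γ w) := by
  have h1 : (gen Γ v)⁻¹ * (gen Γ w)⁻¹ * gen Γ v * gen Γ w = 1 :=
    PresentedGroup.one_of_mem (rels := rels Γ) ⟨v, w, h, rfl⟩
  have h2 : gen Γ v * gen Γ w = gen Γ w * gen Γ v := by
    calc gen Γ v * gen Γ w
        = gen Γ w * gen Γ v * ((gen Γ v)⁻¹ * (gen Γ w)⁻¹ * gen Γ v * gen Γ w) := by group
      _ = gen Γ w * gen Γ v := by rw [h1, mul_one]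
  exact h2

/-- `h^g = g⁻¹ h g`. -/
def conjBy {H : Type*} [Group H] (h g : H) : H := g⁻¹ * h * g

theorem mem_star {x v : V} : v ∈ star Γ x ↔ v = x ∨ Γ.Adj v x := by
  simp [star, perp]

theorem gen_comm_of_mem_star {x v : V} (h : v ∈ star Γ x) : Commute (gen Γ v) (gen Γ x) := by
  rcases (mem_star Γ).1 h with rfl | h
  · exact Commute.refl _
  · exact gen_comm Γ h

variable {Γ}

theorem Comp.mem_verts_of_adj {x v w : V} {C : Comp Γ x} (hv : v ∈ C.verts) (h : Γ.Adj v w)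
    (hw : w ∉ star Γ x) : w ∈ C.verts := by
  obtain ⟨a, ha, rfl⟩ := hv
  refine ⟨⟨w, hw⟩, ?_, rfl⟩
  exact C.mem_supp_of_adj_mem_supp ha (by simpa using h)

theorem Comp.not_mem_star {x v : V} {C : Comp Γ x} (hv : v ∈ C.verts) : v ∉ star Γ x := by
  obtain ⟨a, -, rfl⟩ := hv
  exact a.2

open Classical in
/-- The images of the generators under `α_{C, x^n}`. -/
noncomputable def elemConjFun {x : V} (C : Comp Γ x) (n : ℤ) (v : V) : G Γ :=
  if v ∈ C.verts then conjBy (gen Γ v) (gen Γ x ^ n) else gen Γ v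

theorem elemConjFun_comm {x : V} (C : Comp Γ x) (n : ℤ) {v w : V} (h : Γ.Adj v w) :
    Commute (elemConjFun C n v) (elemConjFun C n w) := by
  have key : ∀ {a b : V}, Γ.Adj a b → a ∈ C.verts → b ∉ C.verts →
      Commute (conjBy (gen Γ a) (gen Γ x ^ n)) (gen Γ b) := by
    intro a b hab ha hb
    have hs : b ∈ star Γ x := by
      by_contra hb'
      exact hb (Comp.mem_verts_of_adj ha hab hb')
    have hc : Commute (gen Γ x ^ n) (gen Γ b) := (gen_comm_of_mem_star Γ hs).symm.zpow_left n
    exact (hc.inv_left.mul_left (gen_comm Γ hab)).mul_left hc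
  unfold elemConjFun
  split_ifs with hv hw hw
  · have := (gen_comm Γ h).map (MulAut.conj (gen Γ x ^ n)⁻¹)
    simpa only [MulAut.conj_apply, inv_inv, conjBy] using this
  · exact key h hv hw
  · exact (key h.symm hw hv).symm
  · exact gen_comm Γ h

/-- The endomorphism `α_{C, x^n}`. -/
noncomputable def elemConjHom {x : V} (C : Comp Γ x) (n : ℤ) : G Γ →* G Γ :=
  PresentedGroup.toGroup (f := elemConjFun C n) (by
    rintro r ⟨v, w, h, rfl⟩
    have := (elemConjFun_comm C n h).eq
    simp only [map_mul, map_inv, FreeGroup.lift_apply_of]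
    rw [mul_assoc, this]
    group)

theorem elemConjHom_gen {x : V} (C : Comp Γ x) (n : ℤ) (v : V) :
    elemConjHom C n (gen Γ v) = elemConjFun C n v :=
  PresentedGroup.toGroup.of _

theorem elemConjHom_comp_neg {x : V} (C : Comp Γ x) (n : ℤ) :
    (elemConjHom C (-n)).comp (elemConjHom C n) = MonoidHom.id (G Γ) := by
  apply PresentedGroup.ext
  intro v
  change elemConjHom C (-n) (elemConjHom C n (gen Γ v)) = gen Γ v
  have hx : elemConjHom C (-n) (gen Γ x) = gen Γ x := by
    rw [elemConjHom_gen, elemConjFun, if_neg]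
    exact fun h => Comp.not_mem_star h ((mem_star Γ).2 (Or.inl rfl))
  rw [elemConjHom_gen]
  by_cases hv : v ∈ C.verts
  · simp only [elemConjFun, if_pos hv, conjBy, map_mul, map_inv, map_zpow, hx, elemConjHom_gen]
    group
  · simp only [elemConjFun, if_neg hv, elemConjHom_gen]

/-- The elementary conjugating automorphism `α_{C, x^ε}`, where `C` is a connected component of
`Γ_{x^⊥}` and `ε = ±1`: it sends `y` to `y^(x^ε)` for `y ∈ C` and fixes all other generators. -/
noncomputable def elemConj {x : V} (C : Comp Γ x) (ε : ℤˣ) : MulAut (G Γ) :=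
  MonoidHom.toMulEquiv (elemConjHom C ε) (elemConjHom C (-(ε : ℤ)))
    (elemConjHom_comp_neg C ε) (by simpa using elemConjHom_comp_neg C (-(ε : ℤ)))

theorem elemConj_gen {x : V} (C : Comp Γ x) (ε : ℤˣ) (v : V) :
    elemConj C ε (gen Γ v) = elemConjFun C (ε : ℤ) v :=
  elemConjHom_gen C (ε : ℤ) v

theorem elemConj_comm {x : V} (C D : Comp Γ x) : Commute (elemConj C 1) (elemConj D 1) := by
  by_cases hCD : C = D
  · rw [hCD]
  have hdisj : ∀ v, v ∈ C.verts → v ∉ D.verts := by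
    rintro _ ⟨a, ha, rfl⟩ ⟨b, hb, hab⟩
    obtain rfl : b = a := Subtype.ext hab
    exact hCD (ha.symm.trans hb)
  have hx : ∀ E : Comp Γ x, x ∉ E.verts :=
    fun E h => Comp.not_mem_star h ((mem_star Γ).2 (Or.inl rfl))
  have hhom : ((elemConj C 1).toMonoidHom.comp (elemConj D 1).toMonoidHom) =
      ((elemConj D 1).toMonoidHom.comp (elemConj C 1).toMonoidHom) := by
    apply PresentedGroup.ext
    intro v
    change elemConj C 1 (elemConj D 1 (gen Γ v)) = elemConj D 1 (elemConj C 1 (gen Γ v))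
    by_cases hC : v ∈ C.verts
    · simp [elemConj_gen, elemConjFun, hC, hdisj v hC, conjBy, hx]
    · by_cases hD : v ∈ D.verts
      · simp [elemConj_gen, elemConjFun, hC, hD, conjBy, hx]
      · simp [elemConj_gen, elemConjFun, hC, hD]
  exact MulEquiv.ext fun g => DFunLike.congr_fun hhom g

variable (Γ)

/-- The group `Conj(G)` of basis-conjugating automorphisms. -/
def ConjAut : Subgroup (MulAut (G Γ)) where
  carrier := {φ | ∀ x, ∃ g : G Γ, φ (gen Γ x) = conjBy (gen Γ x) g}
  one_mem' := fun x => ⟨1, by simp [conjBy]⟩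
  mul_mem' := by
    intro φ ψ hφ hψ x
    obtain ⟨f, hf⟩ := hφ x
    obtain ⟨g, hg⟩ := hψ x
    exact ⟨f * φ g, by simp [conjBy, hf, hg, mul_assoc]⟩
  inv_mem' := by
    intro φ hφ x
    obtain ⟨f, hf⟩ := hφ x
    refine ⟨(φ⁻¹ f)⁻¹, ?_⟩
    have h : gen Γ x = φ⁻¹ (conjBy (gen Γ x) f) := by rw [← hf, MulAut.inv_apply_self]
    simp only [conjBy, map_mul, map_inv] at h ⊢
    rw [inv_inv]
    generalize φ⁻¹ f = a at h ⊢
    conv_rhs => rw [h]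
    group

/-- The group `Conj_N(G)` of normal conjugating automorphisms: on each `𝔞(x)` they act as
conjugation by a single element `f_x`. -/
def ConjN : Subgroup (MulAut (G Γ)) where
  carrier := {φ | φ ∈ ConjAut Γ ∧
    ∀ x, ∃ f : G Γ, ∀ y ∈ adm Γ x, φ (gen Γ y) = conjBy (gen Γ y) f}
  one_mem' := ⟨one_mem _, fun x => ⟨1, by simp [conjBy]⟩⟩
  mul_mem' := by
    rintro φ ψ ⟨hφ, hφ'⟩ ⟨hψ, hψ'⟩
    refine ⟨mul_mem hφ hψ, fun x => ?_⟩
    obtain ⟨f, hf⟩ := hφ' x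
    obtain ⟨g, hg⟩ := hψ' x
    exact ⟨f * φ g, fun y hy => by simp [conjBy, hf y hy, hg y hy, mul_assoc]⟩
  inv_mem' := by
    rintro φ ⟨hφ, hφ'⟩
    refine ⟨inv_mem hφ, fun x => ?_⟩
    obtain ⟨f, hf⟩ := hφ' x
    refine ⟨(φ⁻¹ f)⁻¹, fun y hy => ?_⟩
    have h : gen Γ y = φ⁻¹ (conjBy (gen Γ y) f) := by rw [← hf y hy, MulAut.inv_apply_self]
    simp only [conjBy, map_mul, map_inv] at h ⊢
    rw [inv_inv]
    generalize φ⁻¹ f = a at h ⊢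
    conv_rhs => rw [h]
    group

/-- The elementary singular conjugating automorphisms: the `α_{C, x^ε}` for which `C` is a single
vertex. -/
def LInnS : Set (MulAut (G Γ)) :=
  {φ | ∃ (x : V) (C : Comp Γ x) (ε : ℤˣ), (∃ y, C.verts = {y}) ∧ φ = elemConj C ε}

/-- The group `Conj_S(G)`. -/
def ConjS : Subgroup (MulAut (G Γ)) := Subgroup.closure (LInnS Γ)

variable [Finite V]

/-- The components of `Γ_{x^⊥}` contained in `ℋ_x(y)`; `ℋ_x(y) \ x^⊥` is their union, see
`setH_diff_star`. -/
noncomputable def compsH (x y : V) : Finset (Comp Γ x) :=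
  (Set.toFinite {C : Comp Γ x | C.verts ⊆ setH Γ x {y}}).toFinset

theorem setH_diff_star (x y : V) :
    setH Γ x {y} \ star Γ x = ⋃ C ∈ compsH Γ x y, C.verts := by
  classical
  have hfix : setH Γ x {y} = setK Γ x (setJ Γ x (setH Γ x {y})) :=
    Nat.find_spec (exists_seqH_stable Γ x {y})
  ext v
  simp only [compsH, Set.mem_sdiff, Set.Finite.mem_toFinset, Set.mem_ofPred_eq, Set.mem_iUnion,
    exists_prop]
  constructor
  · rintro ⟨hv, hvx⟩
    have hvC : v ∈ Comp.verts
        ((Γ.induce (star Γ x)ᶜ).connectedComponentMk ⟨v, hvx⟩ : Comp Γ x) :=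
      ⟨⟨v, hvx⟩, rfl, rfl⟩
    refine ⟨_, fun w hw => ?_, hvC⟩
    rw [hfix]
    exact Or.inl (Or.inr (Set.mem_biUnion (show _ from ⟨v, hvC, hv⟩) hw))
  · rintro ⟨C, hC, hv⟩
    exact ⟨hC hv, Comp.not_mem_star hv⟩

/-- The basic normal conjugating automorphism `α̃_{y,x} = ∏ α_{C_i,x}`, where `C_1, …, C_t` are the
components of `Γ_{x^⊥}` whose union is `ℋ_x(y) \ x^⊥`. -/
noncomputable def normConj (y x : V) : MulAut (G Γ) :=
  (compsH Γ x y).noncommProd (fun C => elemConj C 1) fun C _ D _ _ => elemConj_comm C D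

/-- `LInn_N(G)`: the set of all `α̃_{y,x}` with `y ∉ x^⊥`. -/
def LInnN : Set (MulAut (G Γ)) := {φ | ∃ x y : V, y ∉ star Γ x ∧ φ = normConj Γ y x}

/-- `LInn_I(G)`: the set of all `α̃_{y,x}` with `y ∈ Sol(x)`. -/
def LInnI : Set (MulAut (G Γ)) := {φ | ∃ x y : V, y ∈ Sol Γ x ∧ φ = normConj Γ y x}

/-- The group `Conj_I(G)`. -/
def ConjI : Subgroup (MulAut (G Γ)) := Subgroup.closure (LInnI Γ)

end Group

end PCGroup

/-! The proof is peak reduction. A conjugating automorphism `φ` is recorded by its shortest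
conjugators, `φ(y) = y^(g y)` with no first letter of `g y` in `y^⊥` (`IsConjugator`). The key fact,
`IsConjugator.exists_suffix`, is that if `φ ≠ 1` then some `g y` with `y ∉ x^⊥` ends, as a reduced
product, in `x^ε g x`.

Its proof is geometric. A letter `s` with vertex `x` defines a half-space `{h | LL s (g x * h)}`. If
no conjugator has such a suffix, no half-space contains a base point `(g y)⁻¹`. Half-spaces of
distinct non-adjacent vertices are then disjoint (`not_LL_and_LL`), so `φ` respects half-spaces
(`IsConjugator.LL_map_iff`), does not decrease length and, being surjective, is the identity.

The suffix `x^ε g x` passes from a vertex outside `x^⊥` to its neighbours outside `x^⊥`, because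
commuting conjugates have a common conjugator. For normal `φ` it also passes along each `𝔞(u)`.
Hence it is shared by all of `ℋ_x(y) \ x^⊥`, and composing `φ` with `α̃_{y,x}^(-ε)` shortens all
these conjugators at once (`IsConjugator.exists_shorter`). Induction on total length gives
generation by `LInn_N`.

For `φ` also in `Conj_S`, each vertex `z` has a conjugator involving only vertices whose link
contains that of `z` (`exists_mem_par_of_mem_ConjS`). So `x` dominates `ℋ_x(y) \ x^⊥`, and
`α̃_{y,x}` lies in `Conj_S`. By `exists_mem_Sol` it equals some `α̃_{v,x}` with `v ∈ Sol(x)`, so the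
same induction stays inside the intersection. -/

namespace PCGroup

/-! ### Word length, first letters and parabolic subgroups -/

section Length

variable {V : Type*} (Γ : SimpleGraph V)

/-- The element `x^ε` of `G(Γ)` given by a letter `(x, ε)`. -/
def ltr (s : V × ℤˣ) : G Γ := gen Γ s.1 ^ (s.2 : ℤ)

/-- The inverse letter. -/
def linv (s : V × ℤˣ) : V × ℤˣ := (s.1, -s.2)

@[simp] theorem linv_fst (s : V × ℤˣ) : (linv s).1 = s.1 := rfl

@[simp] theorem linv_linv (s : V × ℤˣ) : linv (linv s) = s := by simp [linv]

@[simp] theorem ltr_linv (s : V × ℤˣ) : ltr Γ (linv s) = (ltr Γ s)⁻¹ := by simp [ltr, linv]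

theorem ltr_one (v : V) : ltr Γ (v, 1) = gen Γ v := by simp [ltr]

/-- The element of `G(Γ)` represented by a word. -/
def wd (l : List (V × ℤˣ)) : G Γ := (l.map (ltr Γ)).prod

@[simp] theorem wd_nil : wd Γ [] = 1 := rfl

@[simp] theorem wd_cons (s : V × ℤˣ) (l : List (V × ℤˣ)) : wd Γ (s :: l) = ltr Γ s * wd Γ l := by
  simp [wd]

@[simp] theorem wd_append (l m : List (V × ℤˣ)) : wd Γ (l ++ m) = wd Γ l * wd Γ m := by
  simp [wd]

theorem wd_reverse_inv (l : List (V × ℤˣ)) : wd Γ (l.map linv).reverse = (wd Γ l)⁻¹ := by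
  induction l with
  | nil => simp
  | cons s l ih => simp [ih]

theorem exists_wd (g : G Γ) : ∃ l, wd Γ l = g := by
  have hg : g ∈ Subgroup.closure (Set.range (PresentedGroup.of (rels := rels Γ))) := by
    rw [PresentedGroup.closure_range_of]; trivial
  induction hg using Subgroup.closure_induction with
  | mem x hx =>
    obtain ⟨v, rfl⟩ := hx
    exact ⟨[(v, 1)], by simp [ltr, gen]⟩
  | one => exact ⟨[], rfl⟩
  | mul x y _ _ hx hy =>
    obtain ⟨l, rfl⟩ := hx
    obtain ⟨m, rfl⟩ := hy
    exact ⟨l ++ m, wd_append Γ l m⟩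
  | inv x _ hx =>
    obtain ⟨l, rfl⟩ := hx
    exact ⟨_, wd_reverse_inv Γ l⟩

variable {Γ}

/-- The word length of an element of `G(Γ)`. -/
noncomputable def len (g : G Γ) : ℕ := sInf {n | ∃ l, wd Γ l = g ∧ l.length = n}

theorem exists_reduced (g : G Γ) : ∃ l, wd Γ l = g ∧ l.length = len g := by
  obtain ⟨l, hl⟩ := exists_wd Γ g
  exact Nat.sInf_mem (s := {n | ∃ l, wd Γ l = g ∧ l.length = n}) ⟨_, l, hl, rfl⟩

theorem len_wd_le (l : List (V × ℤˣ)) : len (wd Γ l) ≤ l.length :=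
  Nat.sInf_le ⟨l, rfl, rfl⟩

@[simp] theorem len_one : len (1 : G Γ) = 0 := Nat.le_zero.1 (len_wd_le [])

theorem eq_one_of_len {g : G Γ} (h : len g = 0) : g = 1 := by
  obtain ⟨l, rfl, hl⟩ := exists_reduced g
  rw [h, List.length_eq_zero_iff] at hl
  simp [hl]

theorem len_mul_le (g h : G Γ) : len (g * h) ≤ len g + len h := by
  obtain ⟨l, rfl, hl⟩ := exists_reduced g
  obtain ⟨m, rfl, hm⟩ := exists_reduced h
  rw [← wd_append, ← hl, ← hm, ← List.length_append]
  exact len_wd_le _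

theorem len_inv_le (g : G Γ) : len g⁻¹ ≤ len g := by
  obtain ⟨l, rfl, hl⟩ := exists_reduced g
  rw [← wd_reverse_inv, ← hl]
  exact (len_wd_le _).trans (by simp)

@[simp] theorem len_inv (g : G Γ) : len g⁻¹ = len g :=
  (len_inv_le g).antisymm (by simpa using len_inv_le g⁻¹)

theorem len_ltr_le (s : V × ℤˣ) : len (ltr Γ s) ≤ 1 := by
  simpa using len_wd_le (Γ := Γ) [s]

theorem len_ltr_mul_le (s : V × ℤˣ) (g : G Γ) : len (ltr Γ s * g) ≤ len g + 1 := by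
  have := len_mul_le (ltr Γ s) g
  have := len_ltr_le (Γ := Γ) s
  omega

/-- The parity of the word length. -/
def parity : G Γ →* Multiplicative (ZMod 2) :=
  PresentedGroup.toGroup (f := fun _ => Multiplicative.ofAdd 1) (by
    rintro r ⟨v, w, -, rfl⟩
    simp)

theorem parity_ltr (s : V × ℤˣ) : parity (ltr Γ s) = Multiplicative.ofAdd 1 := by
  have h : parity (gen Γ s.1) = Multiplicative.ofAdd 1 := PresentedGroup.toGroup.of _
  obtain ⟨x, e⟩ := s
  rcases Int.units_eq_one_or e with rfl | rfl
  · simpa [ltr] using h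
  · simp only [ltr, map_zpow, h]
    decide

theorem parity_eq (g : G Γ) : parity g = Multiplicative.ofAdd (len g : ZMod 2) := by
  obtain ⟨l, rfl, hl⟩ := exists_reduced g
  rw [← hl]
  clear hl
  induction l with
  | nil => simp
  | cons s l ih => simp [parity_ltr, ih, mul_comm]

/-- Relators have even length, so length mod 2 is a homomorphism and a letter changes it.
Multiplying by a letter therefore changes the length by exactly one. -/
theorem len_ltr_mul_ne (s : V × ℤˣ) (g : G Γ) : len (ltr Γ s * g) ≠ len g := by
  intro h
  have h1 := parity_eq (ltr Γ s * g)
  rw [map_mul, parity_ltr, parity_eq g, h, mul_eq_right] at h1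
  exact absurd h1 (by decide)

/-- `s` is the first letter of some reduced word for `h`. -/
def LL (s : V × ℤˣ) (h : G Γ) : Prop := len ((ltr Γ s)⁻¹ * h) < len h

theorem LL.len_eq {s : V × ℤˣ} {h : G Γ} (hs : LL s h) :
    len h = len ((ltr Γ s)⁻¹ * h) + 1 := by
  have := len_ltr_mul_le s ((ltr Γ s)⁻¹ * h)
  rw [mul_inv_cancel_left] at this
  unfold LL at hs
  omega

theorem LL_ltr_mul {s : V × ℤˣ} {h : G Γ} : LL s (ltr Γ s * h) ↔ len (ltr Γ s * h) = len h + 1 := by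
  have := len_ltr_mul_le s h
  unfold LL
  rw [inv_mul_cancel_left]
  omega

theorem LL_ltr_mul_iff {s : V × ℤˣ} {h : G Γ} : LL s (ltr Γ s * h) ↔ ¬ LL (linv s) h := by
  have := len_ltr_mul_ne s h
  unfold LL
  rw [inv_mul_cancel_left, ltr_linv, inv_inv]
  omega

theorem len_ltr_mul {s : V × ℤˣ} {h : G Γ} (hs : ¬ LL (linv s) h) :
    len (ltr Γ s * h) = len h + 1 := LL_ltr_mul.1 (LL_ltr_mul_iff.2 hs)

@[simp] theorem not_LL_one (s : V × ℤˣ) : ¬ LL s (1 : G Γ) := by simp [LL]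

@[simp] theorem len_ltr (s : V × ℤˣ) : len (ltr Γ s) = 1 := by
  simpa using len_ltr_mul (not_LL_one (Γ := Γ) (linv s))

theorem LL_ltr (s : V × ℤˣ) : LL s (ltr Γ s) := by simp [LL]

theorem exists_LL {h : G Γ} (hh : h ≠ 1) : ∃ s, LL s h := by
  obtain ⟨l, rfl, hl⟩ := exists_reduced h
  cases l with
  | nil => simp at hh
  | cons s l =>
    refine ⟨s, ?_⟩
    have := len_wd_le (Γ := Γ) l
    rw [LL, ← hl, wd_cons, inv_mul_cancel_left, List.length_cons]
    omega

theorem LL.mul {s : V × ℤˣ} {p w : G Γ} (h : LL s p) (hpw : len (p * w) = len p + len w) :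
    LL s (p * w) := by
  have := len_mul_le ((ltr Γ s)⁻¹ * p) w
  rw [mul_assoc] at this
  unfold LL at *
  omega

/-- The subgroup generated by a set of vertices. -/
def par (Γ : SimpleGraph V) (Y : Set V) : Subgroup (G Γ) := Subgroup.closure (gen Γ '' Y)

theorem gen_mem_par {Y : Set V} {v : V} (hv : v ∈ Y) : gen Γ v ∈ par Γ Y :=
  Subgroup.subset_closure ⟨v, hv, rfl⟩

theorem ltr_mem_par {Y : Set V} {s : V × ℤˣ} (hs : s.1 ∈ Y) : ltr Γ s ∈ par Γ Y :=
  zpow_mem (gen_mem_par hs) _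

theorem par_mono {Y Z : Set V} (h : Y ⊆ Z) : par Γ Y ≤ par Γ Z :=
  Subgroup.closure_mono (Set.image_mono h)

open Classical in
/-- The retraction of `G(Γ)` onto the subgroup generated by `Y`. -/
noncomputable def retr (Γ : SimpleGraph V) (Y : Set V) : G Γ →* G Γ :=
  PresentedGroup.toGroup (f := fun v => if v ∈ Y then gen Γ v else 1) (by
    rintro r ⟨v, w, h, rfl⟩
    have := (gen_comm Γ h).eq
    simp only [map_mul, map_inv, FreeGroup.lift_apply_of]
    split_ifs
    · rw [mul_assoc, this]; group
    all_goals simp)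

open Classical in
theorem retr_gen (Y : Set V) (v : V) : retr Γ Y (gen Γ v) = if v ∈ Y then gen Γ v else 1 :=
  PresentedGroup.toGroup.of _

theorem retr_ltr_of_notMem {Y : Set V} {s : V × ℤˣ} (h : s.1 ∉ Y) : retr Γ Y (ltr Γ s) = 1 := by
  simp [ltr, retr_gen, h]

theorem retr_eq_self {Y : Set V} {h : G Γ} (hh : h ∈ par Γ Y) : retr Γ Y h = h := by
  induction hh using Subgroup.closure_induction with
  | mem x hx =>
    obtain ⟨v, hv, rfl⟩ := hx
    simp [retr_gen, hv]
  | one => simp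
  | mul x y _ _ hx hy => simp [hx, hy]
  | inv x _ hx => simp [hx]

theorem len_retr_le (Y : Set V) (h : G Γ) : len (retr Γ Y h) ≤ len h := by
  obtain ⟨l, rfl, hl⟩ := exists_reduced h
  rw [← hl]
  clear hl
  induction l with
  | nil => simp
  | cons s l ih =>
    rw [wd_cons, map_mul, List.length_cons]
    by_cases hs : s.1 ∈ Y
    · have : retr Γ Y (ltr Γ s) = ltr Γ s := retr_eq_self (ltr_mem_par hs)
      rw [this]
      exact (len_ltr_mul_le _ _).trans (by omega)
    · rw [retr_ltr_of_notMem hs, one_mul]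
      omega

/-- If `s.1 ∉ Y`, the retraction onto `⟨Y⟩` kills `s`, fixes `h` and does not increase length, so
removing `s` from `h` cannot shorten it. -/
theorem LL.mem_of_mem_par {s : V × ℤˣ} {h : G Γ} {Y : Set V} (hs : LL s h) (hh : h ∈ par Γ Y) :
    s.1 ∈ Y := by
  by_contra hY
  have h1 := len_retr_le Y ((ltr Γ s)⁻¹ * h)
  rw [map_mul, map_inv, retr_ltr_of_notMem hY, retr_eq_self hh, inv_one, one_mul] at h1
  unfold LL at hs
  omega

theorem mem_par_of_mul_mem {Y : Set V} {p w : G Γ} (hpw : len (p * w) = len p + len w)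
    (h : p * w ∈ par Γ Y) : p ∈ par Γ Y ∧ w ∈ par Γ Y := by
  induction hn : len p generalizing p with
  | zero => simp_all [eq_one_of_len hn, one_mem]
  | succ n ih =>
    obtain ⟨s, hs⟩ := exists_LL (h := p) (by rintro rfl; simp at hn)
    have hY := (hs.mul hpw).mem_of_mem_par h
    have h1 := hs.len_eq
    have h2 := (hs.mul hpw).len_eq
    have := ih (p := (ltr Γ s)⁻¹ * p) (by rw [mul_assoc]; omega)
      (by rw [mul_assoc]; exact mul_mem (inv_mem (ltr_mem_par hY)) h) (by omega)
    exact ⟨by simpa using mul_mem (ltr_mem_par hY) this.1, this.2⟩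

theorem commute_par_neighborSet {s : V × ℤˣ} {z : G Γ} (hz : z ∈ par Γ (Γ.neighborSet s.1)) :
    Commute (ltr Γ s) z := by
  induction hz using Subgroup.closure_induction with
  | mem x hx =>
    obtain ⟨v, hv, rfl⟩ := hx
    exact (gen_comm Γ hv).zpow_left _
  | one => exact Commute.one_right _
  | mul x y _ _ hx hy => exact hx.mul_right hy
  | inv x _ hx => exact hx.inv_right

/-! ### Hyperplane crossings and the exchange property -/

open Classical in
/-- Right multiplication by `t`, counting the passages from `L` to `L t`. -/
noncomputable def crossPerm (L : Subgroup (G Γ)) (t : G Γ) : Equiv.Perm (G Γ × ℤ) where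
  toFun p := (p.1 * t, p.2 + if p.1 ∈ L then 1 else 0)
  invFun p := (p.1 * t⁻¹, p.2 - if p.1 * t⁻¹ ∈ L then 1 else 0)
  left_inv p := by ext <;> simp
  right_inv p := by ext <;> simp

/-- Right multiplication by `t` on the first factor of `G(Γ) × ℤ`. -/
def rightPerm (t : G Γ) : Equiv.Perm (G Γ × ℤ) where
  toFun p := (p.1 * t, p.2)
  invFun p := (p.1 * t⁻¹, p.2)
  left_inv p := by ext <;> simp
  right_inv p := by ext <;> simp

open Classical in
/-- The right action of `G(Γ)` on `G(Γ) × ℤ` that counts, with signs, the crossings of the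
hyperplane dual to the edge from `1` to the letter `s`. -/
noncomputable def crossAct (s : V × ℤˣ) : G Γ →* (Equiv.Perm (G Γ × ℤ))ᵐᵒᵖ :=
  PresentedGroup.toGroup
    (f := fun v => if v = s.1 then
        MulOpposite.op (crossPerm (par Γ (Γ.neighborSet s.1)) (ltr Γ s)) ^ (s.2 : ℤ)
      else MulOpposite.op (rightPerm (gen Γ v))) (by
    -- Right multiplication by a link vertex `w` preserves the subgroup generated by the link of `s`
    -- and commutes with `s`, so it does not affect the crossing count.
    have key : ∀ w, Γ.Adj s.1 w → Commute (MulOpposite.op (rightPerm (gen Γ w)))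
        (MulOpposite.op (crossPerm (par Γ (Γ.neighborSet s.1)) (ltr Γ s)) ^ (s.2 : ℤ)) := by
      intro w hw
      refine Commute.zpow_right ?_ _
      have hw' : gen Γ w ∈ par Γ (Γ.neighborSet s.1) := gen_mem_par hw
      have hc := commute_par_neighborSet hw'
      apply MulOpposite.unop_injective
      ext p
      · simp [crossPerm, rightPerm, mul_assoc, hc.eq]
      · simp [crossPerm, rightPerm, Subgroup.mul_mem_cancel_right _ hw']
    have aux : ∀ v w, Γ.Adj v w → Commute
        (if v = s.1 then
          MulOpposite.op (crossPerm (par Γ (Γ.neighborSet s.1)) (ltr Γ s)) ^ (s.2 : ℤ)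
          else MulOpposite.op (rightPerm (gen Γ v)))
        (if w = s.1 then
          MulOpposite.op (crossPerm (par Γ (Γ.neighborSet s.1)) (ltr Γ s)) ^ (s.2 : ℤ)
          else MulOpposite.op (rightPerm (gen Γ w))) := by
      intro v w h
      split_ifs with hv hw hw
      · exact Commute.refl _
      · exact (key w (hv ▸ h)).symm
      · exact key v (hw ▸ h.symm)
      · apply MulOpposite.unop_injective
        ext p
        · simp [rightPerm, mul_assoc, (gen_comm Γ h).eq]
        · simp [rightPerm]
    rintro r ⟨v, w, h, rfl⟩
    have := (aux v w h).eq
    simp only [map_mul, map_inv, FreeGroup.lift_apply_of]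
    rw [mul_assoc, this]
    group)

open Classical in
theorem crossAct_gen (s : V × ℤˣ) (v : V) : crossAct (Γ := Γ) s (gen Γ v) =
    if v = s.1 then
        MulOpposite.op (crossPerm (par Γ (Γ.neighborSet s.1)) (ltr Γ s)) ^ (s.2 : ℤ)
      else MulOpposite.op (rightPerm (gen Γ v)) :=
  PresentedGroup.toGroup.of _

theorem crossAct_self (s : V × ℤˣ) : crossAct (Γ := Γ) s (ltr Γ s) =
    MulOpposite.op (crossPerm (par Γ (Γ.neighborSet s.1)) (ltr Γ s)) := by
  have h : ((s.2 : ℤ)) * s.2 = 1 := by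
    rcases Int.units_eq_one_or s.2 with h | h <;> simp [h]
  conv_lhs => rw [ltr, map_zpow, crossAct_gen, if_pos rfl, ← zpow_mul, h, zpow_one]

theorem crossAct_ne {s t : V × ℤˣ} (h : t.1 ≠ s.1) : crossAct (Γ := Γ) s (ltr Γ t) =
    MulOpposite.op (rightPerm (ltr Γ t)) := by
  obtain ⟨y, e⟩ := t
  rcases Int.units_eq_one_or e with rfl | rfl
  · simp only [ltr, map_zpow, crossAct_gen, if_neg h]
    simp
  · simp only [ltr, map_zpow, crossAct_gen, if_neg h]
    simp only [Units.val_neg, Units.val_one, zpow_neg, zpow_one]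
    rfl

theorem eq_or_eq_linv {s t : V × ℤˣ} (h : t.1 = s.1) : t = s ∨ t = linv s := by
  obtain ⟨x, e⟩ := s
  obtain ⟨y, f⟩ := t
  obtain rfl : y = x := h
  rcases Int.units_eq_one_or e with rfl | rfl <;> rcases Int.units_eq_one_or f with rfl | rfl <;>
    simp [linv]

/-- A changed counter must have changed at some letter: `s` read at a point of the link subgroup, or
`s⁻¹` read so as to arrive in it. -/
theorem exists_cross (s : V × ℤˣ) (l : List (V × ℤˣ)) (p : G Γ × ℤ)
    (h : ((crossAct s (wd Γ l)).unop p).2 ≠ p.2) :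
    ∃ l₁ r l₂, l = l₁ ++ r :: l₂ ∧
      ((r = s ∧ p.1 * wd Γ l₁ ∈ par Γ (Γ.neighborSet s.1)) ∨
        (r = linv s ∧ p.1 * wd Γ l₁ * (ltr Γ s)⁻¹ ∈ par Γ (Γ.neighborSet s.1))) := by
  induction l generalizing p with
  | nil => simp at h
  | cons t l ih =>
    rw [wd_cons, map_mul, MulOpposite.unop_mul, Equiv.Perm.mul_apply] at h
    have hfst : ((crossAct s (ltr Γ t)).unop p).1 = p.1 * ltr Γ t := by
      by_cases hts : t.1 = s.1
      · rcases eq_or_eq_linv hts with rfl | rfl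
        · rw [crossAct_self]; rfl
        · rw [ltr_linv, map_inv, crossAct_self]; rfl
      · rw [crossAct_ne hts]; rfl
    by_cases h1 : ((crossAct s (ltr Γ t)).unop p).2 = p.2
    · obtain ⟨l₁, r, l₂, rfl, h2⟩ := ih ((crossAct s (ltr Γ t)).unop p) (by rwa [h1])
      refine ⟨t :: l₁, r, l₂, rfl, ?_⟩
      rw [hfst] at h2
      simpa [mul_assoc] using h2
    · refine ⟨[], t, l, rfl, ?_⟩
      by_cases hts : t.1 = s.1
      · rcases eq_or_eq_linv hts with rfl | rfl
        · left
          rw [crossAct_self] at h1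
          simpa [crossPerm] using h1
        · right
          rw [ltr_linv, map_inv, crossAct_self] at h1
          refine ⟨rfl, ?_⟩
          by_contra h3
          apply h1
          rw [wd_nil, mul_one] at h3
          change p.2 - _ = p.2
          rw [if_neg h3, sub_zero]
      · rw [crossAct_ne hts] at h1
        exact absurd rfl h1

theorem reduced_of_append {l m : List (V × ℤˣ)} (h : len (wd Γ (l ++ m)) = (l ++ m).length) :
    len (wd Γ l) = l.length ∧ len (wd Γ m) = m.length := by
  have h1 := len_mul_le (wd Γ l) (wd Γ m)
  have h2 := len_wd_le (Γ := Γ) l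
  have h3 := len_wd_le (Γ := Γ) m
  rw [wd_append, List.length_append] at h
  omega

theorem notMem_neighborSet (x : V) : x ∉ Γ.neighborSet x := fun h => Γ.irrefl h

theorem not_mem_par_of_reduced {s : V × ℤˣ} {g : G Γ} {h : G Γ}
    (hs : h = g * (ltr Γ s)⁻¹ ∨ h = ltr Γ s * g) (hh : len h = len g + 1) :
    h ∉ par Γ (Γ.neighborSet s.1) := by
  intro hL
  have h1 := retr_eq_self hL
  have h2 := len_retr_le (Γ.neighborSet s.1) g
  have h3 := retr_ltr_of_notMem (Γ := Γ) (notMem_neighborSet (Γ := Γ) s.1)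
  rcases hs with rfl | rfl
  · rw [map_mul, map_inv, h3, inv_one, mul_one] at h1
    rw [h1] at h2
    omega
  · rw [map_mul, h3, one_mul] at h1
    rw [h1] at h2
    omega

/-- A reduced word starting at `1` cannot cross backwards first: its prefix ending in `s⁻¹` would
lie in the link subgroup. So it contains an `s` whose predecessors multiply to an element commuting
with `s`. -/
theorem exists_split_of_cross {s : V × ℤˣ} {l : List (V × ℤˣ)} (hl : len (wd Γ l) = l.length)
    (h : ((crossAct s (wd Γ l)).unop (1, 0)).2 ≠ 0) :
    ∃ l₁ l₂, l = l₁ ++ s :: l₂ ∧ wd Γ l₁ ∈ par Γ (Γ.neighborSet s.1) := by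
  obtain ⟨l₁, r, l₂, rfl, ⟨rfl, hL⟩ | ⟨rfl, hL⟩⟩ := exists_cross s l (1, 0) h
  · exact ⟨l₁, l₂, rfl, by simpa using hL⟩
  · exfalso
    rw [one_mul] at hL
    have h0 : len (wd Γ ((l₁ ++ [linv s]) ++ l₂)) = ((l₁ ++ [linv s]) ++ l₂).length := by
      simpa using hl
    have h1 := (reduced_of_append h0).1
    have h2 := (reduced_of_append h1).1
    refine not_mem_par_of_reduced (g := wd Γ l₁) (Or.inl rfl) ?_ hL
    simpa [h2] using h1

/-- A reduced word beginning with `s` crosses at once. Any later crossing would put a prefix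
beginning with `s` into the link subgroup, or let the first `s` cancel against a later `s⁻¹`; so the
counter stays at 1. -/
theorem LL.cross_ne_zero {s : V × ℤˣ} {h : G Γ} (hs : LL s h) :
    ((crossAct s h).unop (1, 0)).2 ≠ 0 := by
  obtain ⟨l, hl, hlen⟩ := exists_reduced ((ltr Γ s)⁻¹ * h)
  obtain rfl : h = ltr Γ s * wd Γ l := by rw [hl, mul_inv_cancel_left]
  rw [inv_mul_cancel_left] at hlen
  have hred : len (wd Γ (s :: l)) = (s :: l).length := by
    have := LL_ltr_mul.1 hs
    simp [this, hlen]
  rw [map_mul, MulOpposite.unop_mul, Equiv.Perm.mul_apply, crossAct_self]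
  have h1 : (MulOpposite.op (crossPerm (par Γ (Γ.neighborSet s.1)) (ltr Γ s))).unop (1, 0) =
      (ltr Γ s, 1) := by
    simp [crossPerm, one_mem]
  rw [h1]
  by_contra h2
  obtain ⟨l₁, r, l₂, rfl, h | h⟩ := exists_cross s l (ltr Γ s, 1) (by rw [h2]; simp)
  · have h3 : len (wd Γ ((s :: l₁) ++ r :: l₂)) = ((s :: l₁) ++ r :: l₂).length := hred
    have h4 := (reduced_of_append h3).1
    have h5 := (reduced_of_append (l := [s]) (m := l₁) h4).2
    refine not_mem_par_of_reduced (g := wd Γ l₁) (Or.inr rfl) ?_ h.2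
    simpa [h5] using h4
  · obtain ⟨rfl, h⟩ := h
    have h3 : len (wd Γ ((s :: l₁ ++ [linv s]) ++ l₂)) = ((s :: l₁ ++ [linv s]) ++ l₂).length := by
      simpa using hred
    have h4 := (reduced_of_append h3).1
    have hc := commute_par_neighborSet h
    have h5 : wd Γ (s :: l₁ ++ [linv s]) = wd Γ l₁ := by
      simp only at h hc
      have h6 : wd Γ (s :: l₁ ++ [linv s]) = ltr Γ s * wd Γ l₁ * (ltr Γ s)⁻¹ := by
        simp [mul_assoc]
      rw [h6]
      have h7 := hc.eq
      generalize ltr Γ s = a at *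
      have : a * wd Γ l₁ * a⁻¹ = a⁻¹ * (a * (a * wd Γ l₁ * a⁻¹)) := by group
      rw [this, h7]
      group
    rw [h5] at h4
    have := len_wd_le (Γ := Γ) l₁
    simp at h4
    omega

/-- The exchange property. -/
theorem LL.of_mul {s : V × ℤˣ} {p w : G Γ} (hs : LL s (p * w))
    (hpw : len (p * w) = len p + len w) :
    LL s p ∨ (LL s w ∧ p ∈ par Γ (Γ.neighborSet s.1)) := by
  obtain ⟨l, rfl, hl⟩ := exists_reduced p
  obtain ⟨m, rfl, hm⟩ := exists_reduced w
  have hred : len (wd Γ (l ++ m)) = (l ++ m).length := by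
    rw [wd_append, List.length_append]; omega
  have front : ∀ l₁ l₂ : List (V × ℤˣ), len (wd Γ (l₁ ++ s :: l₂)) = (l₁ ++ s :: l₂).length →
      wd Γ l₁ ∈ par Γ (Γ.neighborSet s.1) → LL s (wd Γ (l₁ ++ s :: l₂)) := by
    intro l₁ l₂ h1 h2
    have h3 : (ltr Γ s)⁻¹ * wd Γ (l₁ ++ s :: l₂) = wd Γ (l₁ ++ l₂) := by
      rw [wd_append, wd_cons, ← mul_assoc, ← mul_assoc, mul_assoc _ (wd Γ l₁),
        ← (commute_par_neighborSet h2).eq, inv_mul_cancel_left, wd_append]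
    have h4 := len_wd_le (Γ := Γ) (l₁ ++ l₂)
    rw [LL, h3, h1]
    simp only [List.length_append, List.length_cons] at *
    omega
  rw [← wd_append] at hs
  obtain ⟨l₁, l₂, hsplit, h1⟩ := exists_split_of_cross hred hs.cross_ne_zero
  -- The movable occurrence of `s` lies in `m` or in `l`; the empty overlap below is the case where
  -- it is the first letter of `m`.
  rcases List.append_eq_append_iff.1 hsplit with ⟨a, rfl, rfl⟩ | ⟨a, rfl, ha⟩
  · right
    have h2 := reduced_of_append hred
    have h3 : len (wd Γ ((l ++ a) ++ s :: l₂)) = ((l ++ a) ++ s :: l₂).length := by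
      simpa using hred
    have h4 := (reduced_of_append h3).1
    have h5 := reduced_of_append h4
    rw [wd_append] at h1 h4
    have h6 := mem_par_of_mul_mem (by rw [h4, h5.1, h5.2, List.length_append]) h1
    exact ⟨front _ _ h2.2 h6.2, h6.1⟩
  · cases a with
    | nil =>
      right
      simp only [List.append_nil, List.nil_append] at *
      subst ha
      exact ⟨front [] l₂ hm.symm (one_mem _), h1⟩
    | cons b a =>
      left
      simp only [List.cons_append, List.cons.injEq] at ha
      obtain ⟨rfl, rfl⟩ := ha
      exact front _ _ hl.symm h1

end Length

/-! ### Shortest coset representatives, centralizers and common conjugators -/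

section Cosets

variable {V : Type*} {Γ : SimpleGraph V}

/-- Retraction fixes the vertex. The sign is detected by the crossing counter, which is 1 on `s` and
at most 0 on `s⁻¹`. -/
theorem LL.eq_of_ltr {s t : V × ℤˣ} (h : LL t (ltr Γ s)) : t = s := by
  have h1 := h.len_eq
  rw [len_ltr] at h1
  have h2 : ltr Γ s = ltr Γ t := by
    have := eq_one_of_len (g := (ltr Γ t)⁻¹ * ltr Γ s) (by omega)
    exact (inv_mul_eq_one.1 this).symm
  have h3 : t.1 = s.1 := h.mem_of_mem_par (Y := {s.1}) (ltr_mem_par rfl)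
  rcases eq_or_eq_linv h3 with rfl | rfl
  · rfl
  · exfalso
    unfold LL at h
    rw [ltr_linv, inv_inv] at h
    rw [ltr_linv] at h2
    have h4 : (crossAct (Γ := Γ) s (ltr Γ s)).unop (1, 0) =
      (crossAct s (ltr Γ s)⁻¹).unop (1, 0) := by rw [← h2]
    have h5 : ((crossAct (Γ := Γ) s (ltr Γ s)).unop (1, 0)).2 = 1 := by
      rw [crossAct_self]; simp [crossPerm, one_mem]
    have h6 : ((crossAct (Γ := Γ) s (ltr Γ s)⁻¹).unop (1, 0)).2 ≤ 0 := by
      rw [map_inv, crossAct_self]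
      change (0 : ℤ) - _ ≤ 0
      split_ifs <;> simp
    rw [← h4, h5] at h6
    omega

theorem ltr_injective : Function.Injective (ltr Γ) := by
  intro s t h
  exact LL.eq_of_ltr (h ▸ LL_ltr s)

theorem LL.adj {s t : V × ℤˣ} {h : G Γ} (hs : LL s h) (ht : LL t h) (hst : s ≠ t) :
    Γ.Adj s.1 t.1 := by
  have h1 := hs.len_eq
  have h2 : LL t (ltr Γ s * ((ltr Γ s)⁻¹ * h)) := by rwa [mul_inv_cancel_left]
  rcases h2.of_mul (by rw [mul_inv_cancel_left, len_ltr]; omega) with h3 | ⟨-, h3⟩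
  · exact absurd h3.eq_of_ltr.symm hst
  · exact ((LL_ltr s).mem_of_mem_par h3).symm

/-- No reduced word for `g` starts with a letter from `Y`. -/
def NoL (Y : Set V) (g : G Γ) : Prop := ∀ s : V × ℤˣ, s.1 ∈ Y → ¬ LL s g

/-- Prepend the letters of a reduced word for `c` one by one: by exchange, a cancellation would
occur within `c` or expose a first letter of `g` in `Y`. -/
theorem NoL.len_mul {Y : Set V} {c g : G Γ} (hg : NoL Y g) (hc : c ∈ par Γ Y) :
    len (c * g) = len c + len g := by
  induction hn : len c generalizing c with
  | zero => simp [eq_one_of_len hn]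
  | succ n ih =>
    obtain ⟨s, hs⟩ := exists_LL (h := c) (by rintro rfl; simp at hn)
    have hY := hs.mem_of_mem_par hc
    have h1 := hs.len_eq
    have h2 := ih (c := (ltr Γ s)⁻¹ * c) (mul_mem (inv_mem (ltr_mem_par hY)) hc) (by omega)
    have h3 : ¬ LL (linv s) (((ltr Γ s)⁻¹ * c) * g) := by
      intro h
      rcases h.of_mul (by omega) with h | ⟨h, -⟩
      · have h4 : LL s (ltr Γ s * ((ltr Γ s)⁻¹ * c)) := by rwa [mul_inv_cancel_left]
        exact LL_ltr_mul_iff.1 h4 h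
      · exact hg (linv s) hY h
    have h4 := len_ltr_mul h3
    rw [mul_assoc, mul_inv_cancel_left] at h4
    rw [h4, ← mul_assoc, h2]
    omega

theorem exists_NoL (Y : Set V) (g : G Γ) :
    ∃ c g', c ∈ par Γ Y ∧ NoL Y g' ∧ g = c * g' ∧ len g = len c + len g' := by
  induction hn : len g using Nat.strong_induction_on generalizing g with
  | _ n ih =>
    by_cases h : NoL Y g
    · exact ⟨1, g, one_mem _, h, by simp, by simp [hn]⟩
    · simp only [NoL, not_forall, not_not] at h
      obtain ⟨s, hY, hs⟩ := h
      obtain ⟨c, g', hc, hg', h1, -⟩ := ih _ (lt_of_lt_of_eq hs hn) _ rfl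
      have hc' := mul_mem (ltr_mem_par (Γ := Γ) hY) hc
      have h2 : g = ltr Γ s * c * g' := by rw [mul_assoc, ← h1, mul_inv_cancel_left]
      exact ⟨ltr Γ s * c, g', hc', hg', h2, by rw [← hn, h2, hg'.len_mul hc']⟩

/-- Lengths add for both `(c⁻¹ d) h` and `(c⁻¹ d)⁻¹ g`, which forces `c⁻¹ d` to have length 0. -/
theorem NoL.eq_of_mul_eq {Y : Set V} {c d g h : G Γ} (hg : NoL Y g) (hh : NoL Y h)
    (hc : c ∈ par Γ Y) (hd : d ∈ par Γ Y) (e : c * g = d * h) : g = h := by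
  have h1 : g = (c⁻¹ * d) * h := by rw [mul_assoc, ← e, inv_mul_cancel_left]
  have h2 : h = (c⁻¹ * d)⁻¹ * g := by rw [h1, inv_mul_cancel_left]
  have hm := mul_mem (inv_mem hc) hd
  have h3 := hh.len_mul hm
  have h4 := hg.len_mul (inv_mem hm)
  rw [← h1] at h3
  rw [← h2, len_inv] at h4
  have h5 := eq_one_of_len (g := c⁻¹ * d) (by omega)
  rw [h1, h5, one_mul]

/-- The exchange property for last letters. -/
theorem LL.of_mul_inv {s : V × ℤˣ} {p w : G Γ} (hs : LL s (p * w)⁻¹)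
    (hpw : len (p * w) = len p + len w) :
    LL s w⁻¹ ∨ (LL s p⁻¹ ∧ w ∈ par Γ (Γ.neighborSet s.1)) := by
  rw [mul_inv_rev] at hs
  rcases hs.of_mul (by rw [← mul_inv_rev, len_inv, len_inv, len_inv]; omega) with h | ⟨h, h'⟩
  · exact Or.inl h
  · exact Or.inr ⟨h, by simpa using inv_mem h'⟩

theorem exists_last {h : G Γ} (hh : h ≠ 1) :
    ∃ (r : V × ℤˣ) (h' : G Γ), h = h' * ltr Γ r ∧ len h = len h' + 1 := by
  obtain ⟨s, hs⟩ := exists_LL (inv_ne_one.2 hh)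
  have := hs.len_eq
  refine ⟨linv s, h * ltr Γ s, by simp, ?_⟩
  rw [len_inv] at this
  rw [this, ← len_inv (h * ltr Γ s), mul_inv_rev]

theorem not_LL_of_last {r : V × ℤˣ} {h' : G Γ} (h : len (h' * ltr Γ r) = len h' + 1) :
    ¬ LL r h'⁻¹ := by
  unfold LL
  rw [← mul_inv_rev, len_inv, len_inv]
  omega

theorem LL_of_mul_ltr {s r : V × ℤˣ} {a : G Γ} (h : LL s (a * ltr Γ r)) (h' : ¬ LL s a) :
    r = s ∧ a ∈ par Γ (Γ.neighborSet s.1) ∧ len (a * ltr Γ r) = len a + 1 := by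
  have key : len (a * ltr Γ r) = len a + 1 := by
    by_contra hne
    have h1 := len_ltr_mul_ne (linv r) a⁻¹
    rw [ltr_linv, ← mul_inv_rev, len_inv, len_inv] at h1
    have h2 := len_mul_le a (ltr Γ r)
    rw [len_ltr] at h2
    have h3 := len_mul_le (a * ltr Γ r) (ltr Γ r)⁻¹
    rw [mul_inv_cancel_right, len_inv, len_ltr] at h3
    have h4 : LL s (a * ltr Γ r * (ltr Γ r)⁻¹) := h.mul (by
      rw [mul_inv_cancel_right, len_inv, len_ltr]; omega)
    rw [mul_inv_cancel_right] at h4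
    exact h' h4
  rcases h.of_mul (by rw [key, len_ltr]) with h1 | ⟨h1, h2⟩
  · exact absurd h1 h'
  · exact ⟨h1.eq_of_ltr.symm, h2, key⟩

theorem neighborSet_subset_star (x : V) : Γ.neighborSet x ⊆ star Γ x := fun _ h =>
  (mem_star Γ).2 (Or.inr (SimpleGraph.Adj.symm h))

theorem self_mem_star (x : V) : x ∈ star Γ x := (mem_star Γ).2 (Or.inl rfl)

theorem mem_star_comm {x y : V} : x ∈ star Γ y ↔ y ∈ star Γ x := by
  rw [mem_star, mem_star, Γ.adj_comm, eq_comm]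

/-- A coset representative without first letters in the star of `x` is the gate of the half-spaces
on the two sides of the hyperplane of `x`. -/
theorem NoL.len_inv_mul {k t : G Γ} {s : V × ℤˣ} (hk : NoL (star Γ s.1) k) (hs : LL s t) :
    len (k⁻¹ * t) = len k + len t := by
  induction hn : len t generalizing t with
  | zero => simp [eq_one_of_len hn] at hs
  | succ n ih =>
    obtain ⟨r, t', rfl, ht⟩ := exists_last (h := t) (by rintro rfl; simp at hn)
    by_cases h1 : LL s t'
    · have h2 := ih h1 (by omega)
      have h3 : ¬ LL r (k⁻¹ * t')⁻¹ := by
        intro h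
        rcases h.of_mul_inv (by rw [len_inv, h2]; omega) with h | ⟨h, h'⟩
        · exact not_LL_of_last ht h
        · rw [inv_inv] at h
          exact hk _ (neighborSet_subset_star _ ((h1.mem_of_mem_par h').symm)) h
      have h4 := len_ltr_mul (s := linv r) (by rwa [linv_linv])
      rw [ltr_linv, ← mul_inv_rev, len_inv, len_inv, h2] at h4
      rw [← mul_assoc, h4, add_assoc]
    -- Here the half-space is entered at the last letter, so `t` lies in the star subgroup, where
    -- coset minimality of `k` applies.
    · obtain ⟨rfl, h2, h3⟩ := LL_of_mul_ltr hs h1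
      have h4 : t' * ltr Γ r ∈ par Γ (star Γ r.1) :=
        mul_mem (par_mono (neighborSet_subset_star _) h2) (ltr_mem_par (self_mem_star _))
      have h5 := hk.len_mul (inv_mem h4)
      rw [← len_inv, mul_inv_rev, inv_inv, h5, len_inv]
      omega

theorem commute_ltr_iff {s : V × ℤˣ} {g : G Γ} : Commute (ltr Γ s) g ↔ Commute (gen Γ s.1) g := by
  obtain ⟨x, e⟩ := s
  rcases Int.units_eq_one_or e with rfl | rfl <;> simp [ltr]

theorem commute_of_mem_par_star {y : V} {c : G Γ} (hc : c ∈ par Γ (star Γ y)) :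
    Commute (gen Γ y) c := by
  induction hc using Subgroup.closure_induction with
  | mem x hx =>
    obtain ⟨v, hv, rfl⟩ := hx
    exact (gen_comm_of_mem_star Γ hv).symm
  | one => exact Commute.one_right _
  | mul x y _ _ hx hy => exact hx.mul_right hy
  | inv x _ hx => exact hx.inv_right

/-- The representation of `k` as a product `c k' d` with `c ∈ ⟨Y⟩`, `d ∈ ⟨Z⟩` and `k'` shortest in
its double coset. -/
theorem exists_double_coset (Y Z : Set V) (k : G Γ) :
    ∃ c k' d, c ∈ par Γ Y ∧ d ∈ par Γ Z ∧ k = c * k' * d ∧ NoL Y k' ∧ NoL Z k'⁻¹ := by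
  induction hn : len k using Nat.strong_induction_on generalizing k with
  | _ n ih =>
    by_cases hY : NoL Y k
    · by_cases hZ : NoL Z k⁻¹
      · exact ⟨1, k, 1, one_mem _, one_mem _, by simp, hY, hZ⟩
      · simp only [NoL, not_forall, not_not] at hZ
        obtain ⟨s, hs, h⟩ := hZ
        unfold LL at h
        rw [← mul_inv_rev, len_inv, len_inv, hn] at h
        obtain ⟨c, k', d, hc, hd, h1, h2, h3⟩ := ih _ h _ rfl
        exact ⟨c, k', d * (ltr Γ s)⁻¹, hc, mul_mem hd (inv_mem (ltr_mem_par hs)),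
          by rw [← mul_assoc, ← h1, mul_inv_cancel_right], h2, h3⟩
    · simp only [NoL, not_forall, not_not] at hY
      obtain ⟨s, hs, h⟩ := hY
      unfold LL at h
      rw [hn] at h
      obtain ⟨c, k', d, hc, hd, h1, h2, h3⟩ := ih _ h _ rfl
      refine ⟨ltr Γ s * c, k', d, mul_mem (ltr_mem_par hs) hc, hd, ?_, h2, h3⟩
      rw [mul_assoc _ c, mul_assoc, ← h1, mul_inv_cancel_left]

/-- The centralizer of a generator is generated by its star. -/
theorem mem_par_star_of_commute {y : V} {c : G Γ} (h : Commute (gen Γ y) c) :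
    c ∈ par Γ (star Γ y) := by
  obtain ⟨a, k, b, ha, hb, rfl, h1, h2⟩ := exists_double_coset (star Γ y) (star Γ y) c
  have hk : Commute (gen Γ y) k := by
    have := ((commute_of_mem_par_star ha).inv_right.mul_right h).mul_right
      (commute_of_mem_par_star hb).inv_right
    simpa [mul_assoc] using this
  by_cases hk1 : k = 1
  · simpa [hk1] using mul_mem ha hb
  exfalso
  -- Since `k y = y k` is reduced, a first letter of `k` is one of `y k`; by exchange it is `y` or
  -- adjacent to `y`, against minimality of `k`.
  obtain ⟨s, hs⟩ := exists_LL hk1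
  have hl : len (k * gen Γ y) = len k + 1 := by
    have := len_ltr_mul (s := (y, -1)) (h := k⁻¹) (h2 _ (self_mem_star y))
    rw [← len_inv]
    simpa [ltr] using this
  have h3 : LL s (k * gen Γ y) := hs.mul (by rw [hl, ← ltr_one, len_ltr])
  rw [← hk.eq] at h3 hl
  rcases h3.of_mul (by rw [hl, ← ltr_one, len_ltr, add_comm]) with h4 | ⟨h4, h5⟩
  · rw [← ltr_one] at h4
    obtain rfl := h4.eq_of_ltr
    exact h1 _ (self_mem_star y) hs
  · have h6 : y ∈ Γ.neighborSet s.1 :=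
      (LL_ltr (Γ := Γ) (y, 1)).mem_of_mem_par (by rwa [ltr_one])
    exact h1 s ((mem_star Γ).2 (Or.inr h6)) hs

theorem conjBy_eq_iff {y : V} {g h : G Γ} :
    conjBy (gen Γ y) g = conjBy (gen Γ y) h ↔ g * h⁻¹ ∈ par Γ (star Γ y) := by
  have aux : conjBy (gen Γ y) g = conjBy (gen Γ y) h ↔ Commute (gen Γ y) (g * h⁻¹) := by
    rw [commute_iff_eq, conjBy, conjBy]
    generalize gen Γ y = a
    constructor
    · intro e
      have : a * (g * h⁻¹) = g * (g⁻¹ * a * g) * h⁻¹ := by group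
      rw [this, e]; group
    · intro e
      have : g⁻¹ * a * g = g⁻¹ * (a * (g * h⁻¹)) * h := by group
      rw [this, e]; group
  rw [aux]
  exact ⟨mem_par_star_of_commute, commute_of_mem_par_star⟩

/-- Commuting conjugates of adjacent generators are simultaneously conjugate to these
generators. -/
theorem exists_common_conj {y z : V} {g g' : G Γ}
    (hc : Commute (conjBy (gen Γ y) g) (conjBy (gen Γ z) g')) :
    ∃ a ∈ par Γ (star Γ y), ∃ b ∈ par Γ (star Γ z), a * g = b * g' := by
  obtain ⟨c, k, d, hc', hd, hk, h1, h2⟩ := exists_double_coset (star Γ z) (star Γ y) (g' * g⁻¹)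
  have h3 : Commute (gen Γ y) (k⁻¹ * gen Γ z * k) := by
    have e := hc.eq
    have hg' : g' = c * k * d * g := by rw [← hk, inv_mul_cancel_right]
    have hz : c⁻¹ * gen Γ z * c = gen Γ z := by
      rw [mul_assoc, (commute_of_mem_par_star hc').eq, inv_mul_cancel_left]
    have hy : d * gen Γ y * d⁻¹ = gen Γ y := by
      rw [← (commute_of_mem_par_star hd).eq, mul_inv_cancel_right]
    have e1 : conjBy (gen Γ z) g' = (d * g)⁻¹ * (k⁻¹ * gen Γ z * k) * (d * g) := by
      conv_rhs => rw [← hz]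
      rw [conjBy, hg']
      group
    have e2 : conjBy (gen Γ y) g = (d * g)⁻¹ * gen Γ y * (d * g) := by
      conv_rhs => rw [← hy]
      rw [conjBy]
      group
    rw [e1, e2] at e
    rw [commute_iff_eq]
    generalize k⁻¹ * gen Γ z * k = m at *
    generalize gen Γ y = n at *
    generalize d * g = u at *
    have : n * m = u * (u⁻¹ * n * u * (u⁻¹ * m * u)) * u⁻¹ := by group
    rw [this, e]
    group
  have h4 := mem_par_star_of_commute h3
  have hzk : LL (z, 1) (gen Γ z * k) := by
    rw [← ltr_one]
    exact LL_ltr_mul_iff.2 (h1 _ (self_mem_star z))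
  -- The product `k⁻¹ z k` is reduced and lies in `⟨y^⊥⟩`, so a first letter of `k⁻¹` would be in
  -- `y^⊥`; hence `k = 1`.
  have h5 := NoL.len_inv_mul (s := (z, 1)) (k := k) h1 hzk
  by_cases hk1 : k = 1
  · refine ⟨d, hd, c⁻¹, inv_mem hc', ?_⟩
    rw [hk1, mul_one] at hk
    rw [eq_inv_mul_iff_mul_eq, ← mul_assoc, ← hk, inv_mul_cancel_right]
  · exfalso
    obtain ⟨s, hs⟩ := exists_LL (inv_ne_one.2 hk1)
    have h6 : LL s (k⁻¹ * (gen Γ z * k)) := hs.mul (by rw [len_inv]; exact h5)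
    exact h2 s (h6.mem_of_mem_par (by rwa [← mul_assoc])) hs

/-- If `h = p s k` is reduced, where `s` is the only first letter of `s k` and does not lie in `Y`,
then `s k` is a suffix of the shortest element of the coset `⟨Y⟩h`. -/
theorem NoL.exists_suffix {Y : Set V} {s : V × ℤˣ} {k p c g : G Γ} (hk : NoL (star Γ s.1) k)
    (hg : NoL Y g) (hc : c ∈ par Γ Y) (hs : s.1 ∉ Y)
    (h : len (p * (ltr Γ s * k)) = len p + len (ltr Γ s * k)) (e : c * g = p * (ltr Γ s * k)) :
    ∃ q, g = q * (ltr Γ s * k) ∧ len g = len q + len (ltr Γ s * k) := by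
  -- Strip from `p` its part in `⟨Y⟩`. What remains, `q s k`, has no first letter in `Y`, so it is
  -- `g` by uniqueness.
  obtain ⟨d, q, hd, hq, rfl, hlen⟩ := exists_NoL Y p
  have h1 := len_mul_le d (q * (ltr Γ s * k))
  have h2 := len_mul_le q (ltr Γ s * k)
  rw [mul_assoc] at h
  have h3 : len (q * (ltr Γ s * k)) = len q + len (ltr Γ s * k) := by omega
  have hno : NoL Y (q * (ltr Γ s * k)) := by
    intro t ht hL
    rcases hL.of_mul h3 with h4 | ⟨h4, -⟩
    · exact hq t ht h4
    · have h5 : len (ltr Γ s * k) = len k + 1 := by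
        simpa [add_comm] using hk.len_mul (ltr_mem_par (self_mem_star s.1))
      rcases h4.of_mul (by rw [h5, len_ltr, add_comm]) with h6 | ⟨h6, h7⟩
      · rw [h6.eq_of_ltr] at ht
        exact hs ht
      · exact hk t ((mem_star Γ).2 (Or.inr ((LL_ltr s).mem_of_mem_par h7))) h6
  have h4 := hg.eq_of_mul_eq hno hc hd (by rw [e, mul_assoc])
  exact ⟨q, h4, by rw [← h3, ← h4]⟩

/-- The link subgroup of `s` stabilizes the half-space of `s`: a link letter either lengthens `v`
and commutes past `s`, or cancels, and then exchange keeps `s` in front. -/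
theorem LL_mul_of_mem_par {s : V × ℤˣ} {z v : G Γ} (hz : z ∈ par Γ (Γ.neighborSet s.1)) :
    LL s (z * v) ↔ LL s v := by
  have key : ∀ (r : V × ℤˣ) (v : G Γ), r.1 ∈ Γ.neighborSet s.1 → LL s v → LL s (ltr Γ r * v) := by
    intro r v hr hv
    by_cases h : LL (linv r) v
    · have h1 : LL s ((ltr Γ r)⁻¹ * (ltr Γ r * v)) := by rwa [inv_mul_cancel_left]
      have h2 := h.len_eq
      rw [ltr_linv, inv_inv] at h2
      rcases h1.of_mul (by rw [inv_mul_cancel_left, len_inv, len_ltr]; omega) with h3 | ⟨h3, -⟩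
      · rw [← ltr_linv] at h3
        rw [h3.eq_of_ltr] at hr
        exact absurd hr (notMem_neighborSet _)
      · exact h3
    · have h1 := len_ltr_mul h
      have h2 := hv.len_eq
      have h3 := len_ltr_mul_le r ((ltr Γ s)⁻¹ * v)
      have h4 := (commute_par_neighborSet (ltr_mem_par (Γ := Γ) hr)).inv_left.eq
      rw [← mul_assoc, ← h4, mul_assoc] at h3
      unfold LL
      omega
  induction hz using Subgroup.closure_induction generalizing v with
  | mem x hx =>
    obtain ⟨y, hy, rfl⟩ := hx
    refine ⟨fun h => ?_, fun h => ?_⟩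
    · simpa [ltr] using key (y, -1) _ hy h
    · simpa [ltr] using key (y, 1) _ hy h
  | one => simp
  | mul x y _ _ hx hy => rw [mul_assoc]; exact hx.trans hy
  | inv x _ hx => exact hx.symm.trans (by rw [mul_inv_cancel_left])

theorem conj_mem_par_neighborSet {x : V} {b z : G Γ} (hb : b ∈ par Γ (star Γ x))
    (hz : z ∈ par Γ (Γ.neighborSet x)) : b⁻¹ * z * b ∈ par Γ (Γ.neighborSet x) := by
  have key : par Γ (star Γ x) ≤ Subgroup.normalizer (par Γ (Γ.neighborSet x) : Set (G Γ)) := by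
    rw [par, Subgroup.closure_le]
    rintro _ ⟨v, hv, rfl⟩
    rcases (mem_star Γ).1 hv with rfl | hv
    · rw [SetLike.mem_coe, Subgroup.mem_normalizer_iff]
      intro h
      have hc : ∀ h ∈ par Γ (Γ.neighborSet v), Commute (gen Γ v) h := fun h hh =>
        commute_of_mem_par_star (par_mono (neighborSet_subset_star v) hh)
      constructor
      · intro hh
        rwa [(hc h hh).eq, mul_inv_cancel_right]
      · intro hh
        have := hc _ hh
        have h1 : h = gen Γ v * h * (gen Γ v)⁻¹ := by
          have h2 := this.eq
          generalize gen Γ v = a at *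
          have h3 : a * h * a⁻¹ = a⁻¹ * (a * (a * h * a⁻¹)) := by group
          rw [h3, h2]
          group
        rwa [h1]
    · exact Subgroup.le_normalizer (gen_mem_par hv.symm)
  have := (Subgroup.mem_normalizer_iff.1 (key (inv_mem hb)) z).1 hz
  simpa using this

end Cosets

/-! ### Half-spaces and the suffix theorem for conjugating automorphisms -/

section Conjugating

variable {V : Type*} {Γ : SimpleGraph V}

/-- `φ` conjugates every generator `y` by `g y`, which is the shortest possible conjugator. -/
structure IsConjugator (φ : MulAut (G Γ)) (g : V → G Γ) : Prop where
  map_gen : ∀ y, φ (gen Γ y) = conjBy (gen Γ y) (g y)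
  noL : ∀ y, NoL (star Γ y) (g y)

theorem IsConjugator.map_ltr {φ : MulAut (G Γ)} {g : V → G Γ} (hg : IsConjugator φ g)
    (s : V × ℤˣ) : φ (ltr Γ s) = (g s.1)⁻¹ * ltr Γ s * g s.1 := by
  obtain ⟨x, e⟩ := s
  have := hg.map_gen x
  rcases Int.units_eq_one_or e with rfl | rfl
  · simpa [ltr, conjBy] using this
  · simp [ltr, conjBy, this, mul_assoc]

/-- The prefix of `f y` in `⟨y^⊥⟩` centralizes `y` and can be dropped. -/
theorem exists_isConjugator {φ : MulAut (G Γ)} {f : V → G Γ}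
    (hf : ∀ y, φ (gen Γ y) = conjBy (gen Γ y) (f y)) :
    ∃ g, IsConjugator φ g ∧ ∀ y, len (g y) ≤ len (f y) := by
  choose c g hc hg he hlen using fun y => exists_NoL (star Γ y) (f y)
  refine ⟨g, ⟨fun y => ?_, hg⟩, fun y => by rw [hlen y]; omega⟩
  rw [hf, conjBy_eq_iff, he y, mul_inv_cancel_right]
  exact hc y

/-- Two half-spaces `{h | LL s (g * h)}` and `{h | LL t (k * h)}`, of non-adjacent types and not
containing each other's base points, have no common element `h` whose only last letters are `s`
and `t`. -/
theorem not_LL_and_LL_of_last {s t : V × ℤˣ} {g k h h' : G Γ} (hg : NoL (star Γ s.1) g)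
    (hst : s.1 ≠ t.1) (hadj : ¬ Γ.Adj s.1 t.1) (hk : ¬ LL t (k * g⁻¹))
    (hh : LL t (k * h)) (e : h = h' * ltr Γ s) (ha : g * h' ∈ par Γ (Γ.neighborSet s.1))
    (hlast : ∀ (r : V × ℤˣ) (u : G Γ), h = u * ltr Γ r → len h = len u + 1 → r = s ∨ r = t) :
    False := by
  obtain ⟨a, rfl⟩ : ∃ a, h' = g⁻¹ * a := ⟨g * h', by simp⟩
  rw [mul_inv_cancel_left] at ha
  have hc := (commute_par_neighborSet ha).eq
  by_cases ha1 : a = 1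
  · subst ha1
    rw [mul_one] at e
    rw [e, ← mul_assoc] at hh
    exact hst (congrArg Prod.fst (LL_of_mul_ltr hh hk).1)
  -- The letter `r` is in the link of `s`, so it commutes past `s` and is also a last letter of `h`;
  -- it can be neither `s` nor `t`.
  · obtain ⟨r, b, rfl, hb⟩ := exists_last ha1
    have hmem : ltr Γ s * (b * ltr Γ r) ∈ par Γ (star Γ s.1) :=
      mul_mem (ltr_mem_par (self_mem_star _)) (par_mono (neighborSet_subset_star _) ha)
    have hr : Γ.Adj s.1 r.1 := by
      have h1 : len (b * ltr Γ r) = len b + len (ltr Γ r) := by rw [hb, len_ltr]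
      exact (LL_ltr r).mem_of_mem_par (mem_par_of_mul_mem h1 ha).2
    have hl : len h = len g + len (ltr Γ s * (b * ltr Γ r)) := by
      have := hg.len_mul (inv_mem hmem)
      rw [e, mul_assoc, ← hc, ← len_inv, mul_inv_rev, inv_inv, this, len_inv, add_comm]
    have hl2 : len (ltr Γ s * (b * ltr Γ r)) = len b + 2 := by
      have h1 : ¬ LL (linv s) (b * ltr Γ r) := fun h =>
        notMem_neighborSet (Γ := Γ) s.1 (h.mem_of_mem_par ha)
      rw [len_ltr_mul h1, hb]
    have he : h = (g⁻¹ * (ltr Γ s * b)) * ltr Γ r := by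
      rw [e, mul_assoc, ← hc]; simp only [mul_assoc]
    have hl3 : len h = len (g⁻¹ * (ltr Γ s * b)) + 1 := by
      have h1 := len_mul_le (g⁻¹ * (ltr Γ s * b)) (ltr Γ r)
      rw [← he, len_ltr] at h1
      have h2 := len_mul_le g⁻¹ (ltr Γ s * b)
      have h3 := len_ltr_mul_le s b
      rw [len_inv] at h2
      omega
    rcases hlast r _ he hl3 with rfl | rfl
    · exact Γ.irrefl hr
    · exact hadj hr

/-- Two half-spaces of non-adjacent types that do not contain each other's base points are
disjoint. -/
theorem not_LL_and_LL {s t : V × ℤˣ} {g k : G Γ} (hg : NoL (star Γ s.1) g)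
    (hk : NoL (star Γ t.1) k) (hst : s.1 ≠ t.1) (hadj : ¬ Γ.Adj s.1 t.1)
    (hgk : ¬ LL s (g * k⁻¹)) (hkg : ¬ LL t (k * g⁻¹)) (h : G Γ) :
    ¬ (LL s (g * h) ∧ LL t (k * h)) := by
  induction hn : len h using Nat.strong_induction_on generalizing h with
  | _ n ih =>
    rintro ⟨h1, h2⟩
    -- In a shortest common element, deleting any last letter leaves one of the two half-spaces, so
    -- that letter is `s` or `t`.
    have step : ∀ (r : V × ℤˣ) (u : G Γ), h = u * ltr Γ r → len h = len u + 1 →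
        (r = s ∧ g * u ∈ par Γ (Γ.neighborSet s.1)) ∨
          (r = t ∧ k * u ∈ par Γ (Γ.neighborSet t.1)) := by
      intro r u e hl
      have h3 := ih (len u) (by omega) u rfl
      by_cases h4 : LL s (g * u)
      · have h5 : ¬ LL t (k * u) := fun h5 => h3 ⟨h4, h5⟩
        rw [e, ← mul_assoc] at h2
        have := LL_of_mul_ltr h2 h5
        exact Or.inr ⟨this.1, this.2.1⟩
      · rw [e, ← mul_assoc] at h1
        have := LL_of_mul_ltr h1 h4
        exact Or.inl ⟨this.1, this.2.1⟩
    have hh : h ≠ 1 := by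
      rintro rfl
      rw [mul_one] at h1
      exact hg _ (self_mem_star _) h1
    obtain ⟨r, u, e, hl⟩ := exists_last hh
    rcases step r u e hl with ⟨rfl, h3⟩ | ⟨rfl, h3⟩
    · exact not_LL_and_LL_of_last hg hst hadj hkg h2 e h3 fun r u e hl =>
        (step r u e hl).imp And.left And.left
    · exact not_LL_and_LL_of_last hk hst.symm (fun h => hadj h.symm) hgk h1 e h3 fun r u e hl =>
        (step r u e hl).symm.imp And.left And.left

/-- By `exists_common_conj`, the conjugate of `φ(t)` by `g s.1` lies in the link subgroup of `s`,
which stabilizes the half-space. -/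
theorem IsConjugator.LL_iff_of_adj {φ : MulAut (G Γ)} {g : V → G Γ} (hg : IsConjugator φ g)
    {s t : V × ℤˣ} (hst : Γ.Adj s.1 t.1) (u : G Γ) :
    LL s (g s.1 * (φ (ltr Γ t) * u)) ↔ LL s (g s.1 * u) := by
  have hc : Commute (conjBy (gen Γ t.1) (g t.1)) (conjBy (gen Γ s.1) (g s.1)) := by
    rw [← hg.map_gen, ← hg.map_gen]
    exact (gen_comm Γ hst.symm).map φ
  obtain ⟨a, ha, b, hb, e⟩ := exists_common_conj hc
  have hca : a * ltr Γ t = ltr Γ t * a :=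
    ((commute_ltr_iff.2 (commute_of_mem_par_star ha)).eq).symm
  have hgt : g t.1 = a⁻¹ * (b * g s.1) := by rw [← e, inv_mul_cancel_left]
  have key : g s.1 * (φ (ltr Γ t) * u) = (b⁻¹ * ltr Γ t * b) * (g s.1 * u) := by
    have hca' : a * ltr Γ t * a⁻¹ = ltr Γ t := by rw [hca, mul_inv_cancel_right]
    rw [hg.map_ltr, hgt]
    conv_rhs => rw [← hca']
    group
  rw [key, LL_mul_of_mem_par]
  exact conj_mem_par_neighborSet hb (ltr_mem_par hst)

/-- If no conjugator ends with another one extended by its own letter, then `φ` maps half-spaces to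
half-spaces. -/
theorem IsConjugator.LL_map_iff {φ : MulAut (G Γ)} {g : V → G Γ} (hg : IsConjugator φ g)
    (hno : ∀ (s : V × ℤˣ) y, ¬ LL s (g s.1 * (g y)⁻¹)) (w : G Γ) (s : V × ℤˣ) :
    LL s (g s.1 * φ w) ↔ LL s w := by
  induction hn : len w using Nat.strong_induction_on generalizing w s with
  | _ n ih =>
    have back : ∀ t : V × ℤˣ, LL t w → LL t (g t.1 * φ w) := by
      intro t ht
      obtain ⟨v, rfl⟩ : ∃ v, w = ltr Γ t * v := ⟨(ltr Γ t)⁻¹ * w, by simp⟩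
      have h1 := LL_ltr_mul.1 ht
      have h2 := (ih (len v) (by omega) v (linv t) rfl).not.2 (LL_ltr_mul_iff.1 ht)
      have h3 : g t.1 * φ (ltr Γ t * v) = ltr Γ t * (g t.1 * φ v) := by
        rw [map_mul, hg.map_ltr]; group
      rw [h3]
      exact LL_ltr_mul_iff.2 h2
    refine ⟨fun hs => ?_, back s⟩
    have hw : w ≠ 1 := by
      rintro rfl
      rw [map_one, mul_one] at hs
      exact hg.noL _ _ (self_mem_star _) hs
    -- Compare `s` with a first letter `t` of `w`. If they are adjacent, `φ(t)` can be removed; if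
    -- they differ only in sign, one element would have both as first letters; otherwise their
    -- half-spaces are disjoint.
    obtain ⟨t, ht⟩ := exists_LL hw
    have ht' := back t ht
    by_cases hst : s = t
    · rwa [hst]
    by_cases hadj : Γ.Adj s.1 t.1
    · obtain ⟨v, rfl⟩ : ∃ v, w = ltr Γ t * v := ⟨(ltr Γ t)⁻¹ * w, by simp⟩
      have h1 := LL_ltr_mul.1 ht
      rw [map_mul, hg.LL_iff_of_adj hadj, ih (len v) (by omega) v s rfl] at hs
      exact (LL_mul_of_mem_par (ltr_mem_par hadj)).2 hs
    by_cases hxy : s.1 = t.1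
    · rw [← hxy] at ht'
      exact absurd (hs.adj ht' hst) hadj
    · exact absurd ⟨hs, ht'⟩
        (not_LL_and_LL (hg.noL _) (hg.noL _) hxy hadj (hno _ _) (hno _ _) _)

/-- For `w = s v` reduced, write `k` for `g s.1`. The gate property gives `len (φ w) = len k + 1 +
len (k * φ v)`, which is at least `1 + len (φ v)`. -/
theorem IsConjugator.len_le {φ : MulAut (G Γ)} {g : V → G Γ} (hg : IsConjugator φ g)
    (hno : ∀ (s : V × ℤˣ) y, ¬ LL s (g s.1 * (g y)⁻¹)) (w : G Γ) : len w ≤ len (φ w) := by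
  induction hn : len w generalizing w with
  | zero => simp
  | succ n ih =>
    obtain ⟨s, hs⟩ := exists_LL (h := w) (by rintro rfl; simp at hn)
    obtain ⟨v, rfl⟩ : ∃ v, w = ltr Γ s * v := ⟨(ltr Γ s)⁻¹ * w, by simp⟩
    have h1 := LL_ltr_mul.1 hs
    have h2 := ih v (by omega)
    have h3 := (hg.LL_map_iff hno _ s).2 hs
    have h4 := NoL.len_inv_mul (hg.noL s.1) h3
    have h5 : g s.1 * φ (ltr Γ s * v) = ltr Γ s * (g s.1 * φ v) := by
      rw [map_mul, hg.map_ltr]; group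
    rw [inv_mul_cancel_left, h5] at h4
    rw [h5] at h3
    have h6 := LL_ltr_mul.1 h3
    have h7 := len_mul_le (g s.1)⁻¹ (g s.1 * φ v)
    rw [inv_mul_cancel_left, len_inv] at h7
    omega

/-- Preimages of generators have length 1, so each generator is some `φ(s)`. As `(g s.1)⁻¹ s (g
s.1)` is reduced, the conjugator is trivial. -/
theorem IsConjugator.eq_one {φ : MulAut (G Γ)} {g : V → G Γ} (hg : IsConjugator φ g)
    (hno : ∀ (s : V × ℤˣ) y, ¬ LL s (g s.1 * (g y)⁻¹)) : φ = 1 := by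
  have hg1 : ∀ y, φ (gen Γ y) = gen Γ y := by
    intro y
    have h1 := hg.len_le hno (φ⁻¹ (gen Γ y))
    rw [MulAut.apply_inv_self, ← ltr_one, len_ltr] at h1
    have hne : φ⁻¹ (ltr Γ (y, 1)) ≠ 1 := by
      intro h
      have := len_ltr (Γ := Γ) (y, 1)
      rw [(map_eq_one_iff _ (MulEquiv.injective _)).1 h, len_one] at this
      omega
    obtain ⟨s, hs⟩ := exists_LL hne
    have h2 := hs.len_eq
    have h3 := eq_one_of_len (g := (ltr Γ s)⁻¹ * φ⁻¹ (ltr Γ (y, 1))) (by omega)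
    have h4 : ltr Γ (y, 1) = φ (ltr Γ s) := by
      rw [inv_mul_eq_one.1 h3, MulAut.apply_inv_self]
    have h5 := (hg.noL s.1).len_inv_mul (s := s) (t := ltr Γ s * g s.1)
      (LL_ltr_mul_iff.2 (hg.noL _ _ (self_mem_star _)))
    have h6 := len_ltr_mul (hg.noL s.1 (linv s) (self_mem_star _))
    have h7 := hg.map_ltr s
    rw [← mul_assoc, ← h7, ← h4, len_ltr] at h5
    have h8 := eq_one_of_len (g := g s.1) (by omega)
    rw [h8, inv_one, one_mul, mul_one, ← h4] at h7
    have h9 := ltr_injective h7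
    rw [← h9] at h4
    rw [← ltr_one]
    exact h4.symm
  have : φ.toMonoidHom = MonoidHom.id (G Γ) := PresentedGroup.ext hg1
  exact MulEquiv.ext fun x => DFunLike.congr_fun this x

/-- If `φ ≠ 1` then some conjugator ends with another one extended by its own letter. -/
theorem IsConjugator.exists_suffix {φ : MulAut (G Γ)} {g : V → G Γ} (hg : IsConjugator φ g)
    (hφ : φ ≠ 1) : ∃ (s : V × ℤˣ) (y : V) (q : G Γ), y ∉ star Γ s.1 ∧
      g y = q * (ltr Γ s * g s.1) ∧ len (g y) = len q + len (ltr Γ s * g s.1) := by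
  by_contra hcon
  refine hφ (hg.eq_one ?_)
  intro s y hs
  apply hcon
  have h1 := (hg.noL s.1).len_inv_mul hs
  rw [inv_mul_cancel_left, len_inv] at h1
  obtain ⟨t, ht⟩ : ∃ t, g s.1 * (g y)⁻¹ = ltr Γ s * t := ⟨(ltr Γ s)⁻¹ * (g s.1 * (g y)⁻¹), by simp⟩
  have hgy : g y = t⁻¹ * (ltr Γ (linv s) * g s.1) := by
    have : g y = (g s.1 * (g y)⁻¹)⁻¹ * g s.1 := by group
    rw [this, ht, ltr_linv]; group
  rw [ht] at hs h1
  have h2 := LL_ltr_mul.1 hs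
  have h3 := len_ltr_mul_le (linv s) (g s.1)
  have h4 := len_mul_le t⁻¹ (ltr Γ (linv s) * g s.1)
  rw [← hgy, len_inv] at h4
  -- Passing from `g s.1 * (g y)⁻¹` to `g y` inverts the word, hence the letter `linv s`.
  refine ⟨linv s, y, t⁻¹, fun hy => ?_, hgy, by rw [len_inv, linv_fst]; omega⟩
  rw [linv_fst, mem_star] at hy
  rcases hy with rfl | hy
  · rw [← ht, mul_inv_cancel] at hs
    exact not_LL_one _ hs
  -- If `y` were adjacent to `s.1`, a common conjugator would force `t ∈ ⟨(s.1)^⊥⟩`. Then `linv s`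
  -- moves to the front of `g y`, although its vertex is in `y^⊥`.
  · have hc : Commute (conjBy (gen Γ y) (g y)) (conjBy (gen Γ s.1) (g s.1)) := by
      rw [← hg.map_gen, ← hg.map_gen]
      exact (gen_comm Γ hy).map φ
    obtain ⟨a, ha, b, hb, e⟩ := exists_common_conj hc
    have h5 := (hg.noL y).len_mul ha
    have h6 : a * (ltr Γ s * t)⁻¹ = b := by
      rw [← ht]
      have : a * (g s.1 * (g y)⁻¹)⁻¹ = (a * g y) * (g s.1)⁻¹ := by group
      rw [this, e, mul_inv_cancel_right]
    have h7 : len (a * (ltr Γ s * t)⁻¹) = len a + len (ltr Γ s * t)⁻¹ := by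
      have h8 := len_mul_le (a * (ltr Γ s * t)⁻¹) (g s.1)
      have h9 : a * (ltr Γ s * t)⁻¹ * g s.1 = a * g y := by rw [h6, e]
      have h10 := len_mul_le a (ltr Γ s * t)⁻¹
      rw [h9, h5, h1] at h8
      rw [len_inv] at h10 ⊢
      omega
    have h11 := (mem_par_of_mul_mem h7 (h6 ▸ hb)).2
    have h12 : t ∈ par Γ (star Γ s.1) := by
      have := mul_mem (inv_mem (ltr_mem_par (Γ := Γ) (self_mem_star s.1))) (inv_mem h11)
      simpa using this
    have hcomm := (commute_ltr_iff.2 (commute_of_mem_par_star h12)).eq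
    have h13 : LL (linv s) (g y) := by
      unfold LL
      rw [ltr_linv, inv_inv]
      have h14 : ltr Γ s * g y = t⁻¹ * g s.1 := by
        rw [hgy, ltr_linv, ← mul_assoc, ← mul_assoc]
        have : ltr Γ s * t⁻¹ * (ltr Γ s)⁻¹ = t⁻¹ := by
          rw [(commute_ltr_iff.2 (commute_of_mem_par_star h12)).inv_right.eq, mul_inv_cancel_right]
        rw [this]
      have h15 := len_mul_le t⁻¹ (g s.1)
      rw [h14]
      rw [len_inv] at h15
      omega
    exact hg.noL y (linv s) (mem_star_comm.1 ((mem_star Γ).2 (Or.inr hy))) h13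

/-- A common conjugator for `y` and `z` transports a suffix `s g(x)` of `g(y)` to `g(z)`, if `x` does
not commute with `z`. -/
theorem IsConjugator.suffix_of_common {φ : MulAut (G Γ)} {g : V → G Γ} (hg : IsConjugator φ g)
    {s : V × ℤˣ} {y z : V} {a b q : G Γ} (ha : a ∈ par Γ (star Γ y)) (hb : b ∈ par Γ (star Γ z))
    (e : a * g y = b * g z) (hz : z ∉ star Γ s.1) (hq : g y = q * (ltr Γ s * g s.1))
    (hlen : len (g y) = len q + len (ltr Γ s * g s.1)) :
    ∃ q', g z = q' * (ltr Γ s * g s.1) ∧ len (g z) = len q' + len (ltr Γ s * g s.1) := by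
  have h1 := (hg.noL y).len_mul ha
  have e' : a * g y = a * q * (ltr Γ s * g s.1) := by rw [hq, mul_assoc]
  refine NoL.exists_suffix (p := a * q) (hg.noL s.1) (hg.noL z) hb
    (fun h => hz (mem_star_comm.1 h)) ?_ (e ▸ e')
  have h2 := len_mul_le (a * q) (ltr Γ s * g s.1)
  have h3 := len_mul_le a q
  rw [← e'] at h2 ⊢
  omega

end Conjugating

/-! ### The closure `ℋ_x` and the set `Sol(x)` -/

section Closure

variable {V : Type*} {Γ : SimpleGraph V}

theorem Comp.verts_subset {x v : V} {C : Comp Γ x} {S : Set V} (hv : v ∈ C.verts) (hS : v ∈ S)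
    (hadj : ∀ a b, a ∈ S → a ∉ star Γ x → b ∉ star Γ x → Γ.Adj a b → b ∈ S) : C.verts ⊆ S := by
  obtain ⟨v, hvC, rfl⟩ := hv
  rintro _ ⟨w, hw, rfl⟩
  obtain ⟨p⟩ := SimpleGraph.ConnectedComponent.exact (hvC.trans hw.symm)
  clear hvC hw
  induction p with
  | nil => exact hS
  | @cons a b _ h p ih => exact ih (hadj a b hS a.2 b.2 h)

theorem Comp.verts_nonempty {x : V} (C : Comp Γ x) : C.verts.Nonempty :=
  C.nonempty_supp.image _

theorem self_mem_adm (v : V) : v ∈ adm Γ v := by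
  rintro u ⟨hu, hne⟩
  exact ((mem_star Γ).1 hu).imp Eq.symm SimpleGraph.Adj.symm

/-- Together with its converse below, this replaces domination outside `x^⊥` by inclusion of links.
-/
theorem neighborSet_subset_of_mem_Dom {x v : V} (hv : v ∈ Dom Γ x) (hvx : v ∉ star Γ x) :
    Γ.neighborSet v ⊆ Γ.neighborSet x := by
  intro w hw
  have h1 : w ∈ star Γ v \ {v} := ⟨neighborSet_subset_star v hw, fun h => hw.ne h.symm⟩
  have hD : star Γ x ∩ star Γ v = star Γ v \ {v} := hv
  rw [← hD] at h1
  rcases (mem_star Γ).1 h1.1 with rfl | h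
  · exact absurd (neighborSet_subset_star _ hw.symm) hvx
  · exact h.symm

theorem mem_Dom_of_neighborSet_subset {x v : V} (h : Γ.neighborSet v ⊆ Γ.neighborSet x)
    (hvx : v ∉ star Γ x) : v ∈ Dom Γ x := by
  change star Γ x ∩ star Γ v = star Γ v \ {v}
  ext w
  constructor
  · rintro ⟨h1, h2⟩
    exact ⟨h2, fun e => hvx (e ▸ h1)⟩
  · rintro ⟨h1, h2⟩
    refine ⟨?_, h1⟩
    rcases (mem_star Γ).1 h1 with rfl | h3
    · exact absurd rfl h2
    · exact neighborSet_subset_star x (h h3.symm)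

theorem subset_seqH (x : V) (Y : Set V) (n : ℕ) : Y ⊆ seqH Γ x Y n := by
  induction n with
  | zero => exact subset_rfl
  | succ n ih => exact ih.trans (subset_setK_setJ Γ x _)

variable [Finite V]

theorem setH_eq (x : V) (Y : Set V) : setK Γ x (setJ Γ x (setH Γ x Y)) = setH Γ x Y := by
  classical
  exact (Nat.find_spec (exists_seqH_stable Γ x Y)).symm

theorem subset_setH (x : V) (Y : Set V) : Y ⊆ setH Γ x Y := subset_seqH x Y _

theorem setH_adj {x v w : V} {Y : Set V} (hv : v ∈ setH Γ x Y) (hvx : v ∉ star Γ x)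
    (hw : w ∉ star Γ x) (h : Γ.Adj v w) : w ∈ setH Γ x Y := by
  rw [← setH_eq]
  let C : Comp Γ x := (Γ.induce (star Γ x)ᶜ).connectedComponentMk ⟨v, hvx⟩
  have hvC : v ∈ C.verts := ⟨⟨v, hvx⟩, rfl, rfl⟩
  exact Or.inl (Or.inr (Set.mem_biUnion (show _ from ⟨v, hvC, hv⟩)
    (Comp.mem_verts_of_adj hvC h hw)))

theorem setH_adm {x u v : V} {Y : Set V} (hv : v ∈ setH Γ x Y) (hvx : v ∉ star Γ x)
    (hu : v ∈ adm Γ u) : adm Γ u ⊆ setH Γ x Y := by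
  intro w hw
  rw [← setH_eq]
  exact Or.inr (Set.mem_biUnion (show _ from ⟨v, hu, Or.inl hv, hvx⟩) hw)

/-- Minimality of `ℋ_x(Y)` among supersets closed under both operations, with closure tested only at
vertices outside `x^⊥`. This is its induction principle. -/
theorem setH_subset {x : V} {Y S : Set V} (hY : Y ⊆ S)
    (hadj : ∀ a b, a ∈ S → a ∉ star Γ x → b ∉ star Γ x → Γ.Adj a b → b ∈ S)
    (hadm : ∀ a u, a ∈ S → a ∉ star Γ x → a ∈ adm Γ u → adm Γ u ⊆ S) : setH Γ x Y ⊆ S := by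
  have key : ∀ n, seqH Γ x Y n ⊆ S := by
    intro n
    induction n with
    | zero => exact hY
    | succ n ih =>
      have hJ : setJ Γ x (seqH Γ x Y n) ⊆ S := by
        refine Set.union_subset ih (Set.iUnion₂_subset ?_)
        rintro C ⟨v, hvC, hv⟩
        exact Comp.verts_subset hvC (ih hv) hadj
      refine Set.union_subset hJ (Set.iUnion₂_subset ?_)
      rintro u ⟨v, hu, hv, hvx⟩
      exact hadm v u (hJ hv) hvx hu
  exact key _

theorem setH_subset_of_mem {x y v : V} (h : v ∈ setH Γ x {y}) : setH Γ x {v} ⊆ setH Γ x {y} :=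
  setH_subset (Set.singleton_subset_iff.2 h) (fun _ _ h1 h2 h3 h4 => setH_adj h1 h2 h3 h4)
    (fun _ _ h1 h2 h3 => setH_adm h1 h2 h3)

theorem exists_kMaximal (y : V) : ∃ v, adm Γ y ⊆ adm Γ v ∧ KMaximal Γ v := by
  obtain ⟨m, hm, hmax⟩ := (Set.toFinite (Set.range (adm Γ))).exists_le_maximal ⟨y, rfl⟩
  obtain ⟨v, rfl⟩ := hmax.prop
  exact ⟨v, hm, fun u hu => (hmax.eq_of_le ⟨u, rfl⟩ hu).symm⟩

/-- If `x` dominates all vertices of `ℋ_x(y) \ x^⊥` then `ℋ_x(y)` is generated by an element of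
`Sol(x)`. -/
theorem exists_mem_Sol {x y : V} (hy : y ∉ star Γ x) (hS : y ∈ Sol₀ Γ x) :
    ∃ v ∈ Sol Γ x, setH Γ x {v} = setH Γ x {y} := by
  have hyH : y ∈ setH Γ x {y} := subset_setH x {y} rfl
  obtain ⟨v, hyv, hv⟩ := exists_kMaximal (Γ := Γ) y
  have hyv' := hyv (self_mem_adm y)
  by_cases hvx : v ∈ star Γ x
  -- If the maximal vertex `v` is `x`, domination gives `𝔞(x) ⊆ 𝔞(y)`, so `y` is itself maximal. If
  -- `v` is adjacent to `x`, then `y ∈ 𝔞(v)` puts `y` in `x^⊥`.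
  · rcases (mem_star Γ).1 hvx with rfl | hadj
    · refine ⟨y, ⟨hS, ?_, hy⟩, rfl⟩
      have hD : y ∈ Dom Γ v := (hS hyH).resolve_right hy
      have h1 := neighborSet_subset_of_mem_Dom hD hy
      have h2 : adm Γ v ⊆ adm Γ y := by
        rintro u hu w ⟨hw, hwy⟩
        rcases (mem_star Γ).1 hw with rfl | hw
        · exact absurd rfl hwy
        · have h3 := h1 hw.symm
          exact hu w ⟨neighborSet_subset_star v h3, fun e => h3.ne e.symm⟩
      have h3 := Set.Subset.antisymm hyv h2
      intro u hu
      rw [h3] at hu ⊢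
      exact hv u hu
    · exfalso
      rcases hyv' x ⟨neighborSet_subset_star v hadj, fun e => hadj.ne e.symm⟩ with rfl | h
      · exact hy (self_mem_star _)
      · exact hy ((mem_star Γ).2 (Or.inr h))
  · have h1 : v ∈ setH Γ x {y} := setH_adm hyH hy hyv' (self_mem_adm v)
    have h2 : y ∈ setH Γ x {v} := setH_adm (subset_setH x {v} rfl) hvx (self_mem_adm v) hyv'
    have h3 := Set.Subset.antisymm (setH_subset_of_mem h1) (setH_subset_of_mem h2)
    refine ⟨v, ⟨?_, hv, hvx⟩, h3⟩
    change setH Γ x {v} ⊆ _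
    rw [h3]
    exact hS

end Closure

/-! ### Singular and normal automorphisms, and the length reduction -/

section Normal

variable {V : Type*} {Γ : SimpleGraph V}

open Classical in
theorem noncommProd_elemConj_gen {x : V} (S : Finset (Comp Γ x))
    (hS : (S : Set (Comp Γ x)).Pairwise (Function.onFun Commute fun C => elemConj C 1)) (v : V) :
    S.noncommProd (fun C => elemConj C 1) hS (gen Γ v) =
      if ∃ C ∈ S, v ∈ C.verts then conjBy (gen Γ v) (gen Γ x) else gen Γ v := by
  induction S using Finset.induction_on with
  | empty => simp
  | insert C S hC ih =>
    rw [Finset.noncommProd_insert_of_notMem _ _ _ _ hC, MulAut.mul_apply, ih]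
    have hx : elemConj C 1 (gen Γ x) = gen Γ x := by
      rw [elemConj_gen, elemConjFun, if_neg]
      exact fun h => Comp.not_mem_star h (self_mem_star x)
    by_cases h : ∃ D ∈ S, v ∈ D.verts
    · have hvC : v ∉ C.verts := by
        obtain ⟨D, hD, b, hb, rfl⟩ := h
        rintro ⟨a, ha, hab⟩
        obtain rfl : a = b := Subtype.ext hab
        exact hC (ha.symm.trans hb ▸ hD)
      have h' : ∃ D ∈ insert C S, v ∈ D.verts := by
        obtain ⟨D, hD, hv⟩ := h
        exact ⟨D, Finset.mem_insert_of_mem hD, hv⟩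
      rw [if_pos h, if_pos h']
      simp [conjBy, hx, elemConj_gen, elemConjFun, hvC]
    · rw [if_neg h, elemConj_gen, elemConjFun]
      by_cases hvC : v ∈ C.verts
      · rw [if_pos hvC, if_pos ⟨C, Finset.mem_insert_self C S, hvC⟩]
        simp
      · rw [if_neg hvC, if_neg]
        rintro ⟨D, hD, hv⟩
        rcases Finset.mem_insert.1 hD with rfl | hD
        · exact hvC hv
        · exact h ⟨D, hD, hv⟩

/-- A singleton component `{y}` of `Γ_{x^⊥}` means that the link of `y` lies in that of `x`. Link
inclusion is transitive, so the property survives composition. -/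
theorem exists_mem_par_of_mem_ConjS {φ : MulAut (G Γ)} (hφ : φ ∈ ConjS Γ) (y : V) :
    ∃ f ∈ par Γ {z | Γ.neighborSet y ⊆ Γ.neighborSet z}, φ (gen Γ y) = conjBy (gen Γ y) f := by
  have helem : ∀ (x : V) (C : Comp Γ x) (ε : ℤˣ), (∃ y, C.verts = {y}) → ∀ y,
      ∃ f ∈ par Γ {z | Γ.neighborSet y ⊆ Γ.neighborSet z},
        elemConj C ε (gen Γ y) = conjBy (gen Γ y) f := by
    rintro x C ε ⟨u, hu⟩ y
    rw [elemConj_gen, elemConjFun]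
    split_ifs with hy
    · refine ⟨gen Γ x ^ (ε : ℤ), zpow_mem (gen_mem_par fun w hw => ?_) _, rfl⟩
      have hyx := Comp.not_mem_star hy
      have hwx : w ∈ star Γ x := by
        by_contra hwx
        have hwC := Comp.mem_verts_of_adj hy hw hwx
        rw [hu] at hwC hy
        exact hw.ne (Eq.trans hy (Eq.symm hwC))
      rcases (mem_star Γ).1 hwx with rfl | h
      · exact absurd (neighborSet_subset_star _ (SimpleGraph.Adj.symm hw)) hyx
      · exact h.symm
    · exact ⟨1, one_mem _, by simp [conjBy]⟩
  have hinv : ∀ (x : V) (C : Comp Γ x) (ε : ℤˣ), (elemConj C ε)⁻¹ = elemConj C (-ε) := by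
    intro x C ε
    refine MulEquiv.ext fun a => ?_
    change elemConjHom C (-(ε : ℤ)) a = elemConjHom C ((-ε : ℤˣ) : ℤ) a
    rw [Units.val_neg]
  have hmul : ∀ φ ψ : MulAut (G Γ),
      (∀ y, ∃ f ∈ par Γ {z | Γ.neighborSet y ⊆ Γ.neighborSet z},
        φ (gen Γ y) = conjBy (gen Γ y) f) →
      (∀ y, ∃ f ∈ par Γ {z | Γ.neighborSet y ⊆ Γ.neighborSet z},
        ψ (gen Γ y) = conjBy (gen Γ y) f) →
      ∀ y, ∃ f ∈ par Γ {z | Γ.neighborSet y ⊆ Γ.neighborSet z},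
        (φ * ψ) (gen Γ y) = conjBy (gen Γ y) f := by
    intro φ ψ hφ hψ y
    obtain ⟨f, hf, h1⟩ := hφ y
    obtain ⟨k, hk, h2⟩ := hψ y
    have h3 : φ k ∈ par Γ {z | Γ.neighborSet y ⊆ Γ.neighborSet z} := by
      have : par Γ {z | Γ.neighborSet y ⊆ Γ.neighborSet z} ≤
          (par Γ {z | Γ.neighborSet y ⊆ Γ.neighborSet z}).comap φ.toMonoidHom := by
        conv_lhs => rw [par]
        rw [Subgroup.closure_le]
        rintro _ ⟨z, hz, rfl⟩
        obtain ⟨e, he, h3⟩ := hφ z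
        have he' := par_mono (Y := {w | Γ.neighborSet z ⊆ Γ.neighborSet w})
          (Z := {w | Γ.neighborSet y ⊆ Γ.neighborSet w}) (fun w hw => Set.Subset.trans hz hw) he
        change φ (gen Γ z) ∈ par Γ _
        rw [h3]
        exact mul_mem (mul_mem (inv_mem he') (gen_mem_par hz)) he'
      exact this hk
    exact ⟨f * φ k, mul_mem hf h3, by simp [conjBy, h1, h2, mul_assoc]⟩
  -- The statement is carried for `φ` and `φ⁻¹` together, making the inverse step of the closure
  -- induction a swap.
  have key : (∀ y, ∃ f ∈ par Γ {z | Γ.neighborSet y ⊆ Γ.neighborSet z},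
        φ (gen Γ y) = conjBy (gen Γ y) f) ∧
      (∀ y, ∃ f ∈ par Γ {z | Γ.neighborSet y ⊆ Γ.neighborSet z},
        φ⁻¹ (gen Γ y) = conjBy (gen Γ y) f) := by
    induction hφ using Subgroup.closure_induction with
    | mem φ h =>
      obtain ⟨x, C, ε, hC, rfl⟩ := h
      exact ⟨helem x C ε hC, hinv x C ε ▸ helem x C (-ε) hC⟩
    | one => exact ⟨fun y => ⟨1, one_mem _, by simp [conjBy]⟩,
        fun y => ⟨1, one_mem _, by simp [conjBy]⟩⟩
    | mul φ ψ _ _ h1 h2 =>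
      refine ⟨hmul _ _ h1.1 h2.1, ?_⟩
      rw [mul_inv_rev]
      exact hmul _ _ h2.2 h1.2
    | inv φ _ h => exact ⟨h.2, by rw [inv_inv]; exact h.1⟩
  exact key.1 y

variable [Finite V]

open Classical in
theorem normConj_gen (x y v : V) : normConj Γ y x (gen Γ v) =
    if v ∈ setH Γ x {y} \ star Γ x then conjBy (gen Γ v) (gen Γ x) else gen Γ v := by
  have hiff : (∃ C ∈ compsH Γ x y, v ∈ C.verts) ↔ v ∈ setH Γ x {y} \ star Γ x := by
    rw [setH_diff_star]; simp
  exact (noncommProd_elemConj_gen (compsH Γ x y) _ v).trans (if_congr hiff rfl rfl)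

open Classical in
theorem normConj_zpow_gen (x y v : V) (ε : ℤˣ) : (normConj Γ y x ^ (ε : ℤ)) (gen Γ v) =
    if v ∈ setH Γ x {y} \ star Γ x then conjBy (gen Γ v) (ltr Γ (x, ε)) else gen Γ v := by
  rcases Int.units_eq_one_or ε with rfl | rfl
  · simpa [ltr] using normConj_gen x y v
  · have hx : normConj Γ y x (gen Γ x) = gen Γ x := by
      rw [normConj_gen, if_neg (fun h => h.2 (self_mem_star x))]
    rw [Units.val_neg, Units.val_one, zpow_neg_one]
    apply (normConj Γ y x).injective
    rw [MulAut.apply_inv_self]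
    split_ifs with h
    · simp [conjBy, ltr, hx, normConj_gen, h]
      group
    · rw [normConj_gen, if_neg h]

/-- If `𝔞(u)` meets `ℋ_x(y)` outside `x^⊥`, it lies in `ℋ_x(y)`. Conjugation by `x` then works on
all of it, since `x` commutes with `x^⊥`. -/
theorem normConj_mem_ConjN (x y : V) : normConj Γ y x ∈ ConjN Γ := by
  classical
  refine ⟨fun v => ?_, fun u => ?_⟩
  · rw [normConj_gen]
    split_ifs
    · exact ⟨_, rfl⟩
    · exact ⟨1, by simp [conjBy]⟩
  · by_cases h : ∃ v ∈ adm Γ u, v ∈ setH Γ x {y} \ star Γ x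
    · obtain ⟨v, hv, hvH, hvx⟩ := h
      refine ⟨gen Γ x, fun w hw => ?_⟩
      rw [normConj_gen]
      split_ifs with hwH
      · rfl
      · have hwx : w ∈ star Γ x := by
          by_contra hwx
          exact hwH ⟨setH_adm hvH hvx hv hw, hwx⟩
        rw [conjBy, mul_assoc, (gen_comm_of_mem_star Γ hwx).eq, inv_mul_cancel_left]
    · refine ⟨1, fun w hw => ?_⟩
      rw [normConj_gen, if_neg (fun hwH => h ⟨w, hw, hwH⟩)]
      simp [conjBy]

theorem normConj_congr {x y v : V} (h : setH Γ x {v} = setH Γ x {y}) :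
    normConj Γ v x = normConj Γ y x := by
  unfold normConj compsH
  simp only [h]

/-- A vertex outside `x^⊥` dominated by `x` has all its neighbours in `x^⊥`, so its component is a
single vertex. -/
theorem normConj_mem_ConjS {x y : V} (hS : y ∈ Sol₀ Γ x) : normConj Γ y x ∈ ConjS Γ := by
  refine Subgroup.noncommProd_mem _ _ fun C hC => Subgroup.subset_closure ⟨x, C, 1, ?_, rfl⟩
  have hC' : C.verts ⊆ setH Γ x {y} := by simpa [compsH] using hC
  obtain ⟨v, hv⟩ := C.verts_nonempty
  have hvx := Comp.not_mem_star hv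
  refine ⟨v, (Comp.verts_subset hv (Set.mem_singleton v) ?_).antisymm
    (Set.singleton_subset_iff.2 hv)⟩
  rintro a b rfl - hb hab
  exact absurd (neighborSet_subset_star x
    (neighborSet_subset_of_mem_Dom ((hS (hC' hv)).resolve_right hvx) hvx hab)) hb

/-- A normal conjugating automorphism `φ ≠ 1` can be shortened by some `α̃_{y,x}^{±1}`, such that
the letter `x` occurs in all conjugators for the elements of `ℋ_x(y) \ x^⊥`. -/
theorem IsConjugator.exists_shorter [Fintype V] {φ : MulAut (G Γ)} {g : V → G Γ}
    (hg : IsConjugator φ g) (hφ : φ ∈ ConjN Γ) (hne : φ ≠ 1) :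
    ∃ x y, y ∉ star Γ x ∧ (∃ (ε : ℤˣ) (g' : V → G Γ),
        IsConjugator (φ * normConj Γ y x ^ (ε : ℤ)) g' ∧ ∑ v, len (g' v) < ∑ v, len (g v)) ∧
      ∀ z ∈ setH Γ x {y}, z ∉ star Γ x → ∀ (D : Set V) (f : G Γ),
        φ (gen Γ z) = conjBy (gen Γ z) f → f ∈ par Γ D → x ∈ D := by
  classical
  obtain ⟨s, y, q, hy, hq, hlen⟩ := hg.exists_suffix hne
  have hH : setH Γ s.1 {y} ⊆ {z | z ∉ star Γ s.1 → ∃ q, g z = q * (ltr Γ s * g s.1) ∧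
      len (g z) = len q + len (ltr Γ s * g s.1)} := by
    refine setH_subset ?_ ?_ ?_
    · rintro _ rfl -
      exact ⟨q, hq, hlen⟩
    · rintro a b ha hax - hab hbx
      obtain ⟨q, hq, hlen⟩ := ha hax
      have hc : Commute (conjBy (gen Γ a) (g a)) (conjBy (gen Γ b) (g b)) := by
        rw [← hg.map_gen, ← hg.map_gen]
        exact (gen_comm Γ hab).map φ
      obtain ⟨c, hc, d, hd, e⟩ := exists_common_conj hc
      exact hg.suffix_of_common hc hd e hbx hq hlen
    · rintro a u ha hax hau b hbu hbx
      obtain ⟨q, hq, hlen⟩ := ha hax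
      obtain ⟨f, hf⟩ := hφ.2 u
      have h1 := conjBy_eq_iff.1 ((hf a hau).symm.trans (hg.map_gen a))
      have h2 := conjBy_eq_iff.1 ((hf b hbu).symm.trans (hg.map_gen b))
      exact hg.suffix_of_common h1 h2 (by simp) hbx hq hlen
  have hsl : len (ltr Γ s * g s.1) = len (g s.1) + 1 :=
    len_ltr_mul (hg.noL s.1 (linv s) (self_mem_star _))
  refine ⟨s.1, y, hy, ⟨-s.2, ?_⟩, ?_⟩
  -- With exponent `-s.2`, the factor `φ(s⁻¹) = (g s.1)⁻¹ s⁻¹ (g s.1)` turns `q s (g s.1)` into `q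
  -- (g s.1)`, removing the letter `s`.
  · let f : V → G Γ := fun v =>
      if v ∈ setH Γ s.1 {y} \ star Γ s.1 then g v * φ (ltr Γ (linv s)) else g v
    have hf : ∀ v, (φ * normConj Γ y s.1 ^ ((-s.2 : ℤˣ) : ℤ)) (gen Γ v) =
        conjBy (gen Γ v) (f v) := by
      intro v
      rw [MulAut.mul_apply, normConj_zpow_gen]
      simp only [f]
      split_ifs
      · simp only [conjBy, map_mul, map_inv, hg.map_gen v, mul_inv_rev, mul_assoc]
        rfl
      · exact hg.map_gen v
    have hlt : ∀ v ∈ setH Γ s.1 {y} \ star Γ s.1, len (f v) < len (g v) := by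
      intro v hv
      obtain ⟨q, hq, hl⟩ := hH hv.1 hv.2
      have : f v = q * g s.1 := by
        simp only [f, if_pos hv]
        rw [hg.map_ltr, linv_fst, ltr_linv, hq]
        group
      have h1 := len_mul_le q (g s.1)
      rw [this]
      omega
    obtain ⟨g', hg', hle⟩ := exists_isConjugator hf
    refine ⟨g', hg', Finset.sum_lt_sum (fun v _ => ?_) ⟨y, Finset.mem_univ y,
      (hle y).trans_lt (hlt y ⟨subset_setH _ _ rfl, hy⟩)⟩⟩
    by_cases hv : v ∈ setH Γ s.1 {y} \ star Γ s.1
    · exact (hle v).trans (hlt v hv).le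
    · refine (hle v).trans (le_of_eq ?_)
      simp only [f, if_neg hv]
  · intro z hz hzx D f hf hfD
    obtain ⟨q, hq, hl⟩ := hH hz hzx
    have h1 := conjBy_eq_iff.1 (hf.symm.trans (hg.map_gen z))
    have h2 := (hg.noL z).len_mul h1
    rw [inv_mul_cancel_right] at h2
    -- The shortest conjugator is a reduced suffix of every conjugator `f`, so its letters,
    -- including `s`, have vertices in `D`.
    have h3 := (mem_par_of_mul_mem (p := f * (g z)⁻¹) (w := g z)
      (by rwa [inv_mul_cancel_right]) (by rwa [inv_mul_cancel_right])).2
    rw [hq] at h3 hl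
    have h4 := (mem_par_of_mul_mem hl h3).2
    exact ((LL_ltr_mul.2 hsl).mem_of_mem_par h4)

/-- Induction on the total length of the shortest conjugators, serving both halves of the theorem.
Membership of `α̃_{y,x}` in `N` keeps the shortened automorphism in `N`; membership in `K` lets it
be undone. -/
theorem le_of_normConj_mem {N K : Subgroup (MulAut (G Γ))} (hN : N ≤ ConjN Γ)
    (h : ∀ φ ∈ N, ∀ x y, y ∉ star Γ x →
      (∀ z ∈ setH Γ x {y}, z ∉ star Γ x → ∀ (D : Set V) (f : G Γ),
        φ (gen Γ z) = conjBy (gen Γ z) f → f ∈ par Γ D → x ∈ D) →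
      normConj Γ y x ∈ N ⊓ K) : N ≤ K := by
  have := Fintype.ofFinite V
  have key : ∀ (n : ℕ) (φ : MulAut (G Γ)) (g : V → G Γ), φ ∈ N → IsConjugator φ g →
      ∑ v, len (g v) = n → φ ∈ K := by
    intro n
    induction n using Nat.strong_induction_on with
    | _ n ih =>
      intro φ g hφ hg hn
      by_cases hne : φ = 1
      · exact hne ▸ one_mem K
      obtain ⟨x, y, hy, ⟨ε, g', hg', hlt⟩, hD⟩ := hg.exists_shorter (hN hφ) hne
      obtain ⟨hmemN, hmemK⟩ := Subgroup.mem_inf.1 (h φ hφ x y hy hD)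
      have := ih _ (hn ▸ hlt) _ g' (mul_mem hφ (zpow_mem hmemN _)) hg' rfl
      simpa using mul_mem this (inv_mem (zpow_mem hmemK (ε : ℤ)))
  intro φ hφ
  choose f hf using (hN hφ).1
  obtain ⟨g, hg, -⟩ := exists_isConjugator hf
  exact key _ φ g hφ hg rfl

end Normal

end PCGroup

theorem mainTheorem8 {V : Type*} [Finite V] (Γ : SimpleGraph V) :
    PCGroup.ConjN Γ = Subgroup.closure (PCGroup.LInnN Γ) ∧
      PCGroup.ConjN Γ ⊓ PCGroup.ConjS Γ = PCGroup.ConjI Γ := by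
  refine ⟨le_antisymm (PCGroup.le_of_normConj_mem le_rfl fun φ _ x y hy _ =>
    ⟨PCGroup.normConj_mem_ConjN x y, Subgroup.subset_closure ⟨x, y, hy, rfl⟩⟩) ?_,
    le_antisymm (PCGroup.le_of_normConj_mem inf_le_left fun φ hφ x y hy hD => ?_) ?_⟩
  · rw [Subgroup.closure_le]
    rintro _ ⟨x, y, -, rfl⟩
    exact PCGroup.normConj_mem_ConjN x y
  · have hS : y ∈ PCGroup.Sol₀ Γ x := by
      intro z hz
      by_cases hzx : z ∈ PCGroup.star Γ x
      · exact Or.inr hzx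
      -- Taking `D` to be the vertices whose link contains that of `z`, the occurrence of `x` in `f`
      -- says that `x` dominates `z`.
      · obtain ⟨f, hf, e⟩ := PCGroup.exists_mem_par_of_mem_ConjS hφ.2 z
        exact Or.inl (PCGroup.mem_Dom_of_neighborSet_subset (hD z hz hzx _ f e hf) hzx)
    obtain ⟨v, hv, e⟩ := PCGroup.exists_mem_Sol hy hS
    exact ⟨⟨PCGroup.normConj_mem_ConjN x y, PCGroup.normConj_mem_ConjS hS⟩,
      PCGroup.normConj_congr e ▸ Subgroup.subset_closure ⟨x, v, hv, rfl⟩⟩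
  · rw [PCGroup.ConjI, Subgroup.closure_le]
    rintro _ ⟨x, y, hy, rfl⟩
    exact ⟨PCGroup.normConj_mem_ConjN x y, PCGroup.normConj_mem_ConjS hy.1⟩
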